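/- **Conventions.** For points of a metric space put $(y|z)_x=\frac12(|x-y|+|x-z|-|y-z|)$. A metric space is $\delta$-hyperbolic if $(x|z)_t\ge\min\{(x|y)_t,(y|z)_t\}-\delta$ for all $x,y,z,t$; a subset is $\delta$-hyperbolic if it is so for the induced metric. $A^{+\alpha}$ is the set of points at distance at most $\alpha$ from $A$ (with $\emptyset^{+\alpha}=\emptyset$). A subset $A$ of a geodesic space is $\alpha$-quasi-convex if every geodesic between two points of $A$ lies in $A^{+\alpha}$. Let $r_0>0$. The cone $C(A)$ over a metric space $A$ is $A\times[0,r_0]$ with all points $(y,0)$ identified to one point, the vertex, and with the metric $$|(y,r)-(y',r')|=\operatorname{arccosh}\bigl(\cosh r\cosh r'-\sinh r\sinh r'\cos\min\{\pi,|y-y'|/\sinh r_0\}\bigr).$$ Given a metric space $X$ and a family $Y=(Y_i)_{i\in I}$ of subsets, the cone-off $\dot X(Y)$ is obtained from $X\sqcup\bigsqcup_i C(Y_i)$ by gluing each $(y,r_0)\in C(Y_i)$ to $y\in Y_i\subset X$; its vertices are the vertices of the cones $C(Y_i)$. For $x,x'\in\dot X(Y)$ let $\|x-x'\|\in[0,\infty]$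 be the minimal distance in the disjoint union (distinct components being at infinite distance) between a preimage of $x$ and a preimage of $x'$. The metric of $\dot X(Y)$ is the infimum of $\sum_{j}\|z_j-z_{j+1}\|$ over all finite chains $x=z_1,\dots,z_m=x'$ of points of $\dot X(Y)$. If $X$ is $\delta$-hyperbolic, the largest piece of $Y$ is $$\Delta(Y)=\sup_{i\ne j}\operatorname{diam}\bigl(Y_i^{+20\delta}\cap Y_j^{+20\delta}\bigr)\in[0,\infty].$$ **Theorem (Second hyperbolicity theorem).** Let $r_0>0$ and $\varepsilon>0$. There exist $\delta,\Delta>0$, depending only on $r_0$ and $\varepsilon$, with the following property. Let $X$ be a geodesic $\delta$-hyperbolic metric space and $Y=(Y_i)_{i\in I}$ a family of closed $10\delta$-quasi-convex subsets of $X$ with $\Delta(Y)\le\Delta$. If $x_0\in\dot X(Y)$ is at distance greater than $r_0/2$ from every vertex of $\dot X(Y)$, then the open ball $B(x_0,r_0/9)\subset\dot X(Y)$ is $(\ln 3+\varepsilon)$-hyperbolic. -/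

import Mathlib

open scoped ENNReal

noncomputable section

/-! ### Hyperbolicity, geodesics, quasi-convexity -/

/-- The Gromov product `(y|z)_x`. -/
def gromovProduct {X : Type*} [PseudoMetricSpace X] (y z x : X) : ℝ :=
  (dist x y + dist x z - dist y z) / 2

/-- Four-point definition of `δ`-hyperbolicity: `(x|z)_t ≥ min {(x|y)_t, (y|z)_t} - δ`. -/
def IsGromovHyperbolic (X : Type*) [PseudoMetricSpace X] (δ : ℝ) : Prop :=
  ∀ x y z t : X,
    min (gromovProduct x y t) (gromovProduct y z t) - δ ≤ gromovProduct x z t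

/-- `γ`, restricted to `[0, dist x x']`, is a geodesic from `x` to `x'`. -/
def IsGeodesicBetween {X : Type*} [PseudoMetricSpace X] (γ : ℝ → X) (x x' : X) : Prop :=
  γ 0 = x ∧ γ (dist x x') = x' ∧
    ∀ s ∈ Set.Icc 0 (dist x x'), ∀ t ∈ Set.Icc 0 (dist x x'), dist (γ s) (γ t) = |s - t|

/-- Any two points are joined by a geodesic. -/
def IsGeodesicSpace (X : Type*) [PseudoMetricSpace X] : Prop :=
  ∀ x x' : X, ∃ γ : ℝ → X, IsGeodesicBetween γ x x'

/-- `Y` is `α`-quasi-convex: every geodesic between two points of `Y` is contained in the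
`α`-neighbourhood `{x | d(x, Y) ≤ α}` of `Y`. -/
def IsQuasiConvex {X : Type*} [PseudoMetricSpace X] (α : ℝ) (Y : Set X) : Prop :=
  ∀ y ∈ Y, ∀ y' ∈ Y, ∀ γ : ℝ → X, IsGeodesicBetween γ y y' →
    ∀ t ∈ Set.Icc 0 (dist y y'), γ t ∈ Metric.cthickening α Y

/-- The largest piece of the collection `(Y i)`:
`sup_{i ≠ j} diam (Y_i^{+20δ} ∩ Y_j^{+20δ})`, as an element of `[0, ∞]`. -/
def largestPiece {X I : Type*} [PseudoMetricSpace X] (δ : ℝ) (Y : I → Set X) : ℝ≥0∞ :=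
  ⨆ (i : I) (j : I) (_ : i ≠ j),
    Metric.ediam (Metric.cthickening (20 * δ) (Y i) ∩ Metric.cthickening (20 * δ) (Y j))

/-! ### The cone of radius `r₀` over a metric space -/

/-- Two points of `Y × [0, r₀]` are identified iff they are equal or both have radius `0`. -/
def coneSetoid (r₀ : ℝ) (Y : Type*) : Setoid (Y × Set.Icc (0 : ℝ) r₀) where
  r p q := p = q ∨ ((p.2 : ℝ) = 0 ∧ (q.2 : ℝ) = 0)
  iseqv :=
    { refl := fun _ => Or.inl rfl
      symm := fun h => h.elim (fun h => Or.inl h.symm) (fun h => Or.inr ⟨h.2, h.1⟩)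
      trans := by
        rintro p q s (rfl | h) (rfl | h')
        · exact Or.inl rfl
        · exact Or.inr h'
        · exact Or.inr h
        · exact Or.inr ⟨h.1, h'.2⟩ }

/-- The cone `C(Y)` of radius `r₀` over `Y`. -/
def Cone (r₀ : ℝ) (Y : Type*) : Type _ := Quotient (coneSetoid r₀ Y)

/-- The point `(y, r)` of `C(Y)`. -/
def Cone.mk {r₀ : ℝ} {Y : Type*} (y : Y) (r : Set.Icc (0 : ℝ) r₀) : Cone r₀ Y :=
  Quotient.mk (coneSetoid r₀ Y) (y, r)

/-- The angle `min {π, d(y, y') / sinh r₀}`. -/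
def coneAngle {Y : Type*} [PseudoMetricSpace Y] (r₀ : ℝ) (y y' : Y) : ℝ :=
  min Real.pi (dist y y' / Real.sinh r₀)

/-- The hyperbolic distance on the cone,
`arcosh (cosh r cosh r' - sinh r sinh r' cos (angle))`. -/
def Cone.distance {r₀ : ℝ} {Y : Type*} [PseudoMetricSpace Y] : Cone r₀ Y → Cone r₀ Y → ℝ :=
  Quotient.lift₂
    (fun p q : Y × Set.Icc (0 : ℝ) r₀ =>
      Real.arcosh (Real.cosh p.2 * Real.cosh q.2 -
        Real.sinh p.2 * Real.sinh q.2 * Real.cos (coneAngle r₀ p.1 q.1)))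
    (by
      rintro p q p' q' (rfl | ⟨h1, h2⟩) (rfl | ⟨h3, h4⟩)
      · rfl
      · simp [h3, h4]
      · simp [h1, h2]
      · simp [h1, h2, h3, h4])

/-! ### The cone-off -/

/-- The disjoint union of `X` and of the cones `C(Y i)`. -/
abbrev ConeOffSum {X I : Type*} (r₀ : ℝ) (Y : I → Set X) : Type _ :=
  X ⊕ (Σ i : I, Cone r₀ (Y i))

/-- The metric of the disjoint union: distinct components are at infinite distance. -/
def ConeOffSum.distance {X I : Type*} [MetricSpace X] {r₀ : ℝ} {Y : I → Set X} :
    ConeOffSum r₀ Y → ConeOffSum r₀ Y → ℝ≥0∞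
  | .inl x, .inl x' => edist x x'
  | .inr c, .inr c' =>
      ⨅ (i : I) (u : Cone r₀ (Y i)) (u' : Cone r₀ (Y i)) (_ : c = ⟨i, u⟩) (_ : c' = ⟨i, u'⟩),
        ENNReal.ofReal (Cone.distance u u')
  | .inl _, .inr _ => ∞
  | .inr _, .inl _ => ∞

/-- The gluing: a point `y` of `Y i`, viewed in `X`, is identified with the point `(y, r₀)`
of the cone `C(Y i)`. -/
def coneOffGlue {X I : Type*} (r₀ : ℝ) (Y : I → Set X) (a b : ConeOffSum r₀ Y) : Prop :=
  ∃ (i : I) (y : Y i) (r : Set.Icc (0 : ℝ) r₀), (r : ℝ) = r₀ ∧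
    a = .inl (y : X) ∧ b = .inr ⟨i, Cone.mk y r⟩

/-- The cone-off: the quotient of the disjoint union by the equivalence relation generated by
the gluing. -/
def ConeOff {X I : Type*} (r₀ : ℝ) (Y : I → Set X) : Type _ := Quot (coneOffGlue r₀ Y)

/-- The canonical projection onto the cone-off. -/
def ConeOff.proj {X I : Type*} {r₀ : ℝ} {Y : I → Set X} (a : ConeOffSum r₀ Y) :
    ConeOff r₀ Y :=
  Quot.mk _ a

/-- The vertices of the cone-off: the images of the points `(y, 0)` of the cones. -/
def ConeOff.vertices {X I : Type*} (r₀ : ℝ) (Y : I → Set X) : Set (ConeOff r₀ Y) :=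
  {v | ∃ (i : I) (y : Y i) (r : Set.Icc (0 : ℝ) r₀), (r : ℝ) = 0 ∧
    v = ConeOff.proj (.inr ⟨i, Cone.mk y r⟩)}

/-- The length of a one-step chain: the minimal distance, in the disjoint union, between
preimages of `x` and `x'`. -/
def ConeOff.link {X I : Type*} [MetricSpace X] {r₀ : ℝ} {Y : I → Set X}
    (x x' : ConeOff r₀ Y) : ℝ≥0∞ :=
  ⨅ (a : ConeOffSum r₀ Y) (a' : ConeOffSum r₀ Y)
    (_ : ConeOff.proj a = x) (_ : ConeOff.proj a' = x'), ConeOffSum.distance a a'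

/-- The infimum of the lengths of the chains `z 0, …, z n` between `x` and `x'`. -/
def ConeOff.chainDist {X I : Type*} [MetricSpace X] {r₀ : ℝ} {Y : I → Set X}
    (x x' : ConeOff r₀ Y) : ℝ≥0∞ :=
  ⨅ (n : ℕ) (z : ℕ → ConeOff r₀ Y) (_ : z 0 = x) (_ : z n = x'),
    ∑ j ∈ Finset.range n, ConeOff.link (z j) (z (j + 1))

section

variable {X I : Type*} [MetricSpace X] {r₀ : ℝ} {Y : I → Set X}

theorem Cone.distance_comm {Z : Type*} [PseudoMetricSpace Z] (u v : Cone r₀ Z) :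
    Cone.distance u v = Cone.distance v u := by
  induction u using Quotient.inductionOn
  induction v using Quotient.inductionOn
  simp only [Cone.distance, Quotient.lift₂_mk, coneAngle, dist_comm]
  congr 1
  ring

theorem ConeOffSum.distance_comm (a b : ConeOffSum r₀ Y) :
    ConeOffSum.distance a b = ConeOffSum.distance b a := by
  rcases a with x | c <;> rcases b with x' | c'
  · exact edist_comm x x'
  · rfl
  · rfl
  · apply le_antisymm <;>
    · simp only [ConeOffSum.distance]
      refine le_iInf fun i => le_iInf fun u => le_iInf fun u' => le_iInf fun h => le_iInf fun h' => ?_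
      rw [Cone.distance_comm]
      exact iInf_le_of_le i (iInf_le_of_le u' (iInf_le_of_le u (iInf_le_of_le h' (iInf_le _ h))))

theorem ConeOffSum.distance_cone (i : I) (u u' : Cone r₀ (Y i)) :
    ConeOffSum.distance (.inr ⟨i, u⟩ : ConeOffSum r₀ Y) (.inr ⟨i, u'⟩) =
      ENNReal.ofReal (Cone.distance u u') := by
  apply le_antisymm
  · exact iInf_le_of_le i (iInf_le_of_le u (iInf_le_of_le u' (iInf_le_of_le rfl (iInf_le _ rfl))))
  · refine le_iInf fun j => le_iInf fun v => le_iInf fun v' => le_iInf fun h => le_iInf fun h' => ?_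
    obtain ⟨rfl, h⟩ := Sigma.mk.inj_iff.1 h
    obtain ⟨-, h'⟩ := Sigma.mk.inj_iff.1 h'
    rw [eq_of_heq h, eq_of_heq h']

theorem ConeOff.link_comm (x x' : ConeOff r₀ Y) : ConeOff.link x x' = ConeOff.link x' x := by
  apply le_antisymm <;>
  · refine le_iInf fun a => le_iInf fun a' => le_iInf fun h => le_iInf fun h' => ?_
    rw [ConeOffSum.distance_comm]
    exact iInf_le_of_le a' (iInf_le_of_le a (iInf_le_of_le h' (iInf_le _ h)))

theorem ConeOff.link_proj_le (a b : ConeOffSum r₀ Y) :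
    ConeOff.link (ConeOff.proj a) (ConeOff.proj b) ≤ ConeOffSum.distance a b :=
  iInf_le_of_le a (iInf_le_of_le b (iInf_le_of_le rfl (iInf_le _ rfl)))

theorem ConeOff.chainDist_le_link (x x' : ConeOff r₀ Y) :
    ConeOff.chainDist x x' ≤ ConeOff.link x x' := by
  refine iInf_le_of_le 1 (iInf_le_of_le (fun n => if n = 0 then x else x')
    (iInf_le_of_le (by simp) (iInf_le_of_le (by simp) ?_)))
  simp

theorem ConeOff.chainDist_self (x : ConeOff r₀ Y) : ConeOff.chainDist x x = 0 := by
  refine le_antisymm ?_ (zero_le)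
  refine iInf_le_of_le 0 (iInf_le_of_le (fun _ => x)
    (iInf_le_of_le rfl (iInf_le_of_le rfl ?_)))
  simp

theorem ConeOff.chainDist_le_symm (x x' : ConeOff r₀ Y) :
    ConeOff.chainDist x x' ≤ ConeOff.chainDist x' x := by
  refine le_iInf fun n => le_iInf fun z => le_iInf fun h => le_iInf fun h' => ?_
  refine iInf_le_of_le n (iInf_le_of_le (fun k => z (n - k))
    (iInf_le_of_le (by simpa using h') (iInf_le_of_le (by simpa using h) (le_of_eq ?_))))
  rw [← Finset.sum_range_reflect]
  refine Finset.sum_congr rfl fun j hj => ?_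
  have hj := Finset.mem_range.1 hj
  have h1 : n - (n - 1 - j) = j + 1 := by omega
  have h2 : n - (n - 1 - j + 1) = j := by omega
  simp only [h1, h2]
  exact ConeOff.link_comm _ _

theorem ConeOff.chainDist_triangle (x y w : ConeOff r₀ Y) :
    ConeOff.chainDist x w ≤ ConeOff.chainDist x y + ConeOff.chainDist y w := by
  have key : ∀ (n : ℕ) (z : ℕ → ConeOff r₀ Y) (m : ℕ) (t : ℕ → ConeOff r₀ Y),
      z 0 = x → z n = y → t 0 = y → t m = w →
      ConeOff.chainDist x w ≤ ∑ j ∈ Finset.range n, ConeOff.link (z j) (z (j + 1)) +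
        ∑ j ∈ Finset.range m, ConeOff.link (t j) (t (j + 1)) := by
    intro n z m t hz hzn ht htm
    refine iInf_le_of_le (n + m) (iInf_le_of_le (fun k => if k < n then z k else t (k - n))
      (iInf_le_of_le ?_ (iInf_le_of_le (by simp [htm]) (le_of_eq ?_))))
    · rcases Nat.eq_zero_or_pos n with rfl | hn
      · simp [ht, ← hz, ← hzn]
      · simp [hn, hz]
    · rw [Finset.sum_range_add]
      congr 1
      · refine Finset.sum_congr rfl fun j hj => ?_
        have hj := Finset.mem_range.1 hj
        by_cases h : j + 1 < n
        · simp [hj, h]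
        · have : j + 1 = n := by omega
          simp [hj, this, ht, hzn]
      · refine Finset.sum_congr rfl fun j _ => ?_
        have h1 : ¬ (n + j < n) := by omega
        have h2 : ¬ (n + j + 1 < n) := by omega
        have h3 : n + j + 1 - n = j + 1 := by omega
        simp [h2, h3]
  conv_rhs => unfold ConeOff.chainDist
  simp only [ENNReal.iInf_add]
  refine le_iInf fun n => le_iInf fun z => le_iInf fun hz => le_iInf fun hzn => ?_
  simp only [ENNReal.add_iInf]
  exact le_iInf fun m => le_iInf fun t => le_iInf fun ht => le_iInf fun htm =>
    key n z m t hz hzn ht htm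

theorem ConeOff.exists_base (x : ConeOff r₀ Y) :
    ∃ b : X, ConeOff.chainDist x (ConeOff.proj (.inl b)) ≠ ∞ := by
  induction x using Quot.inductionOn with
  | _ a =>
  rcases a with b | ⟨i, u⟩
  · refine ⟨b, ?_⟩
    change ConeOff.chainDist (ConeOff.proj (.inl b)) _ ≠ ∞
    rw [ConeOff.chainDist_self]
    exact ENNReal.zero_ne_top
  · induction u using Quotient.inductionOn with
    | _ p =>
    obtain ⟨y, r⟩ := p
    have hr : (0 : ℝ) ≤ r₀ := r.2.1.trans r.2.2
    refine ⟨y, ne_top_of_le_ne_top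
      (ENNReal.ofReal_ne_top (r := Cone.distance (Cone.mk y r) (Cone.mk y ⟨r₀, hr, le_rfl⟩)))
      ((ConeOff.chainDist_le_link _ _).trans ?_)⟩
    · have hglue : (ConeOff.proj (.inl (y : X)) : ConeOff r₀ Y) =
          ConeOff.proj (.inr ⟨i, Cone.mk y ⟨r₀, hr, le_rfl⟩⟩) :=
        Quot.sound ⟨i, y, ⟨r₀, hr, le_rfl⟩, rfl, rfl, rfl⟩
      rw [hglue]
      exact (ConeOff.link_proj_le _ _).trans (ConeOffSum.distance_cone i _ _).le

theorem ConeOff.chainDist_ne_top (x x' : ConeOff r₀ Y) : ConeOff.chainDist x x' ≠ ∞ := by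
  obtain ⟨b, hb⟩ := ConeOff.exists_base x
  obtain ⟨b', hb'⟩ := ConeOff.exists_base x'
  have h : ConeOff.chainDist (ConeOff.proj (.inl b) : ConeOff r₀ Y) (ConeOff.proj (.inl b')) ≠ ∞ :=
    ne_top_of_le_ne_top (edist_ne_top b b')
      ((ConeOff.chainDist_le_link _ _).trans (ConeOff.link_proj_le _ _))
  refine ne_top_of_le_ne_top ?_ ((ConeOff.chainDist_triangle x (ConeOff.proj (.inl b)) x').trans
    (add_le_add_right (ConeOff.chainDist_triangle _ (ConeOff.proj (.inl b')) x') _))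
  exact ENNReal.add_ne_top.2 ⟨hb, ENNReal.add_ne_top.2
    ⟨h, ne_top_of_le_ne_top hb' (ConeOff.chainDist_le_symm _ _)⟩⟩

end

/-- The cone-off with the distance `inf {l(C) | C a chain between x and x'}`. -/
instance ConeOff.instPseudoMetricSpace {X I : Type*} [MetricSpace X] {r₀ : ℝ} {Y : I → Set X} :
    PseudoMetricSpace (ConeOff r₀ Y) :=
  letI : PseudoEMetricSpace (ConeOff r₀ Y) :=
    { edist := ConeOff.chainDist
      edist_self := ConeOff.chainDist_self
      edist_comm := fun x y =>
        le_antisymm (ConeOff.chainDist_le_symm x y) (ConeOff.chainDist_le_symm y x)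
      edist_triangle := ConeOff.chainDist_triangle }
  PseudoEMetricSpace.toPseudoMetricSpace ConeOff.chainDist_ne_top

end

/-! In the hyperbolic plane, let `v` lie on a geodesic `[P, Q]` at distance `σ` from `P`. Stewart's
formula gives, for every `R`, `|R - v| ≤ max (|R - P| - σ) (|R - Q| - (|P - Q| - σ)) + ln 2`. The
proof establishes this coarse CAT(-1) comparison, with a small additional error, for points of
bounded subsets of the cone-off (`ConeOff.exists_comparison_point`). It implies hyperbolicity: given
`x, y, z, t`, take `v` between `t` and `y` at parameter `s = min {(x|y)_t, (y|z)_t}`. For `R = x`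
and `R = z` the maximum is its first term, and the triangle inequality through `v` gives `(x|z)_t ≥
s - ln 2 - small`. Since `ln 2 ≤ ln 3`, this suffices.

For a single cone over a coarsely convex subset of an almost tree-like space, the comparison point
is copied from the plane, and its base point is chosen along the base
(`Cone.exists_comparison_point`).

For the cone-off, the constants `δ` and `Δ` must be small compared with the number of steps of a
chain. A chain of bounded length can be replaced by one with at most `N` steps, where `N` depends
only on the scale and the precision (`ConeOff.exists_walk_le`): short chords of a cone are pushed
into `X` at little cost, and there is room for few long ones. An error `K` made at each step then
adds up to at most a multiple of `N * K`.

Nearest point projections to the `Y i` have two properties up to `K`: a geodesic with a long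
projection passes near both ends of the projection, and the projection of one member of the family
to another is small, because pieces are small. They induce coarse projections of the cone-off to
each cone (`HasCoarseGates`).

A point at parameter `s` between `t` and `y` is either inside a cone containing an end, or at the
level of a point `w` of a geodesic of `X` between the base points of `t` and `y`. If one cone
extends from `w` towards both `t` and `y`, comparison takes place in that cone. Otherwise `w` is a
coarse cut point: a short chain from a third point `x` to `t` or to `y` passes near it, and `w`
itself is the comparison point. -/

noncomputable section

/-! ### Hyperbolic trigonometry -/

/-- The right-hand side of the hyperbolic law of cosines. -/
def coshLaw (r r' φ : ℝ) : ℝ :=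
  Real.cosh r * Real.cosh r' - Real.sinh r * Real.sinh r' * Real.cos φ

theorem coshLaw_comm (r r' φ : ℝ) : coshLaw r r' φ = coshLaw r' r φ := by
  unfold coshLaw; ring

theorem coshLaw_le_of_cos_le {r r' φ φ' : ℝ} (hr : 0 ≤ r) (hr' : 0 ≤ r')
    (h : Real.cos φ' ≤ Real.cos φ) : coshLaw r r' φ ≤ coshLaw r r' φ' := by
  unfold coshLaw
  have := mul_le_mul_of_nonneg_left h
    (mul_nonneg (Real.sinh_nonneg_iff.2 hr) (Real.sinh_nonneg_iff.2 hr'))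
  linarith

theorem cosh_sub_le_coshLaw {r r' : ℝ} (φ : ℝ) (hr : 0 ≤ r) (hr' : 0 ≤ r') :
    Real.cosh (r - r') ≤ coshLaw r r' φ := by
  have h := coshLaw_le_of_cos_le (φ := 0) (φ' := φ) hr hr' (by simpa using Real.cos_le_one φ)
  rw [Real.cosh_sub]
  simpa [coshLaw] using h

theorem one_le_coshLaw {r r' : ℝ} (φ : ℝ) (hr : 0 ≤ r) (hr' : 0 ≤ r') : 1 ≤ coshLaw r r' φ :=
  (Real.one_le_cosh _).trans (cosh_sub_le_coshLaw φ hr hr')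

/-- The two squares are the components of `sinh` of the third side along and across the side `r'`,
by the laws of cosines and sines at its far end. -/
theorem coshLaw_sq_sub_one (r r' φ : ℝ) :
    coshLaw r r' φ ^ 2 - 1 =
      (Real.cosh r * Real.sinh r' - Real.sinh r * Real.cosh r' * Real.cos φ) ^ 2 +
        (Real.sinh r * Real.sin φ) ^ 2 := by
  have h1 := Real.cosh_sq r
  have h2 := Real.cosh_sq r'
  have h3 := Real.sin_sq_add_cos_sq φ
  unfold coshLaw
  have h1' : Real.sinh r ^ 2 = Real.cosh r ^ 2 - 1 := by linarith
  have h2' : Real.sinh r' ^ 2 = Real.cosh r' ^ 2 - 1 := by linarith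
  have h3' : Real.sin φ ^ 2 = 1 - Real.cos φ ^ 2 := by linarith
  ring_nf
  rw [h1', h2', h3']
  ring

theorem coshLaw_add_le (r₁ r₂ r₃ α β : ℝ) :
    coshLaw r₁ r₃ (α + β) ≤ coshLaw r₁ r₂ α * coshLaw r₂ r₃ β +
      √(coshLaw r₁ r₂ α ^ 2 - 1) * √(coshLaw r₂ r₃ β ^ 2 - 1) := by
  rw [coshLaw_comm r₂ r₃, coshLaw_sq_sub_one, coshLaw_sq_sub_one]
  set p₁ := Real.cosh r₁ * Real.sinh r₂ - Real.sinh r₁ * Real.cosh r₂ * Real.cos α with hp₁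
  set p₃ := Real.cosh r₃ * Real.sinh r₂ - Real.sinh r₃ * Real.cosh r₂ * Real.cos β with hp₃
  set q₁ := Real.sinh r₁ * Real.sin α with hq₁
  set q₃ := Real.sinh r₃ * Real.sin β with hq₃
  -- The remainder is the scalar product of `(p₁, q₁)` and `(-p₃, q₃)`, so the claim becomes the
  -- Cauchy-Schwarz inequality.
  have key : coshLaw r₁ r₃ (α + β) = coshLaw r₁ r₂ α * coshLaw r₃ r₂ β + (-(p₁ * p₃) + q₁ * q₃) := by
    have h2 : Real.sinh r₂ ^ 2 = Real.cosh r₂ ^ 2 - 1 := by linarith [Real.cosh_sq r₂]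
    rw [hp₁, hp₃, hq₁, hq₃]
    unfold coshLaw
    rw [Real.cos_add]
    ring_nf
    rw [h2]
    ring
  rw [key, ← Real.sqrt_mul (by positivity)]
  gcongr
  refine Real.le_sqrt_of_sq_le ?_
  nlinarith [sq_nonneg (p₁ * q₃ + q₁ * p₃)]

theorem arcosh_coshLaw_add_le {r₁ r₂ r₃ : ℝ} (h₁ : 0 ≤ r₁) (h₂ : 0 ≤ r₂) (h₃ : 0 ≤ r₃) (α β : ℝ) :
    Real.arcosh (coshLaw r₁ r₃ (α + β)) ≤
      Real.arcosh (coshLaw r₁ r₂ α) + Real.arcosh (coshLaw r₂ r₃ β) := by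
  have hA := one_le_coshLaw α h₁ h₂
  have hB := one_le_coshLaw β h₂ h₃
  have hC := one_le_coshLaw (α + β) h₁ h₃
  have hnn := add_nonneg (Real.arcosh_nonneg hA) (Real.arcosh_nonneg hB)
  rw [← Real.arcosh_cosh hnn]
  refine (Real.arcosh_le_arcosh (by linarith) (Real.cosh_pos _)).2 ?_
  rw [Real.cosh_add, Real.cosh_arcosh hA, Real.cosh_arcosh hB, Real.sinh_arcosh hA,
    Real.sinh_arcosh hB]
  exact coshLaw_add_le _ _ _ _ _

/-- The distance between the points at heights `r`, `r'` of a cone of radius `r₀` whose base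
points are at distance `ℓ`. -/
def coneMetric (r₀ r r' ℓ : ℝ) : ℝ :=
  Real.arcosh (coshLaw r r' (min Real.pi (ℓ / Real.sinh r₀)))

section

variable {r₀ r r' ℓ : ℝ}

theorem coneMetric_comm (r₀ r r' ℓ : ℝ) : coneMetric r₀ r r' ℓ = coneMetric r₀ r' r ℓ := by
  unfold coneMetric; rw [coshLaw_comm]

theorem coneMetric_nonneg (hr : 0 ≤ r) (hr' : 0 ≤ r') : 0 ≤ coneMetric r₀ r r' ℓ :=
  Real.arcosh_nonneg (one_le_coshLaw _ hr hr')

theorem cosh_coneMetric (hr : 0 ≤ r) (hr' : 0 ≤ r') :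
    Real.cosh (coneMetric r₀ r r' ℓ) = coshLaw r r' (min Real.pi (ℓ / Real.sinh r₀)) :=
  Real.cosh_arcosh (one_le_coshLaw _ hr hr')

theorem coneMetric_zero (r₀ r r' : ℝ) : coneMetric r₀ r r' 0 = |r - r'| := by
  unfold coneMetric coshLaw
  rw [zero_div, min_eq_right Real.pi_pos.le, Real.cos_zero, mul_one, ← Real.cosh_sub,
    ← Real.cosh_abs, Real.arcosh_cosh (abs_nonneg _)]

theorem arcosh_le_arcosh_of_one_le {x y : ℝ} (hx : 1 ≤ x) (h : x ≤ y) :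
    Real.arcosh x ≤ Real.arcosh y :=
  (Real.arcosh_le_arcosh (by linarith) (by linarith)).2 h

theorem le_of_cosh_le_cosh {x y : ℝ} (hy : 0 ≤ y) (h : Real.cosh x ≤ Real.cosh y) : x ≤ y := by
  have := Real.cosh_le_cosh.1 h
  rw [abs_of_nonneg hy] at this
  exact (le_abs_self x).trans this

theorem cos_min_pi_le {φ ψ : ℝ} (hφ : 0 ≤ φ) (h : φ ≤ ψ) :
    Real.cos (min Real.pi ψ) ≤ Real.cos (min Real.pi φ) :=
  Real.cos_le_cos_of_nonneg_of_le_pi (le_min Real.pi_pos.le hφ) (min_le_left _ _)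
    (min_le_min le_rfl h)

theorem coneMetric_mono (hr₀ : 0 < r₀) (hr : 0 ≤ r) (hr' : 0 ≤ r') {ℓ' : ℝ} (hℓ : 0 ≤ ℓ)
    (h : ℓ ≤ ℓ') : coneMetric r₀ r r' ℓ ≤ coneMetric r₀ r r' ℓ' := by
  have hS := Real.sinh_pos_iff.2 hr₀
  refine arcosh_le_arcosh_of_one_le (one_le_coshLaw _ hr hr')
    (coshLaw_le_of_cos_le hr hr' (cos_min_pi_le (by positivity) ?_))
  gcongr

theorem abs_sub_le_coneMetric (hr₀ : 0 < r₀) (hr : 0 ≤ r) (hr' : 0 ≤ r') (hℓ : 0 ≤ ℓ) :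
    |r - r'| ≤ coneMetric r₀ r r' ℓ := by
  rw [← coneMetric_zero r₀]
  exact coneMetric_mono hr₀ hr hr' le_rfl hℓ

theorem coneMetric_triangle (hr₀ : 0 < r₀) {r₁ r₂ r₃ ℓ₁₂ ℓ₂₃ ℓ₁₃ : ℝ} (h₁ : 0 ≤ r₁) (h₂ : 0 ≤ r₂)
    (h₃ : 0 ≤ r₃) (h₁₂ : 0 ≤ ℓ₁₂) (h₂₃ : 0 ≤ ℓ₂₃) (h₁₃ : 0 ≤ ℓ₁₃) (h : ℓ₁₃ ≤ ℓ₁₂ + ℓ₂₃) :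
    coneMetric r₀ r₁ r₃ ℓ₁₃ ≤ coneMetric r₀ r₁ r₂ ℓ₁₂ + coneMetric r₀ r₂ r₃ ℓ₂₃ := by
  have hS := Real.sinh_pos_iff.2 hr₀
  have hpi := Real.pi_pos
  set α := min Real.pi (ℓ₁₂ / Real.sinh r₀) with hα
  set β := min Real.pi (ℓ₂₃ / Real.sinh r₀) with hβ
  set γ := min Real.pi (ℓ₁₃ / Real.sinh r₀) with hγ
  have hα0 : 0 ≤ α := le_min hpi.le (by positivity)
  have hβ0 : 0 ≤ β := le_min hpi.le (by positivity)
  have hγ0 : 0 ≤ γ := le_min hpi.le (by positivity)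
  have hα1 : α ≤ Real.pi := min_le_left _ _
  have hβ1 : β ≤ Real.pi := min_le_left _ _
  have hγ1 : γ ≤ Real.pi := min_le_left _ _
  have hsum : γ ≤ α + β := by
    rcases le_total Real.pi (ℓ₁₂ / Real.sinh r₀) with h1 | h1
    · rw [hα, min_eq_left h1]; linarith
    rcases le_total Real.pi (ℓ₂₃ / Real.sinh r₀) with h2 | h2
    · rw [hβ, min_eq_left h2]; linarith
    rw [hα, hβ, min_eq_right h1, min_eq_right h2, ← add_div]
    exact (min_le_right _ _).trans (by gcongr)
  -- The cosine is monotone only up to `π`. Shrinking `α` keeps the sum at least `γ` and brings it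
  -- to at most `π`.
  set α' := min α (Real.pi - β) with hα'
  have hα'0 : 0 ≤ α' := le_min hα0 (by linarith)
  have h5 : γ ≤ α' + β := by
    rcases le_total α (Real.pi - β) with h1 | h1
    · rw [hα', min_eq_left h1]; exact hsum
    · rw [hα', min_eq_right h1]; linarith
  have h6 : α' + β ≤ Real.pi := by linarith [min_le_right α (Real.pi - β)]
  calc coneMetric r₀ r₁ r₃ ℓ₁₃ ≤ Real.arcosh (coshLaw r₁ r₃ (α' + β)) :=
        arcosh_le_arcosh_of_one_le (one_le_coshLaw _ h₁ h₃)
          (coshLaw_le_of_cos_le h₁ h₃ (Real.cos_le_cos_of_nonneg_of_le_pi hγ0 h6 h5))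
    _ ≤ Real.arcosh (coshLaw r₁ r₂ α') + Real.arcosh (coshLaw r₂ r₃ β) :=
        arcosh_coshLaw_add_le h₁ h₂ h₃ _ _
    _ ≤ _ := by
        refine add_le_add_left (arcosh_le_arcosh_of_one_le (one_le_coshLaw _ h₁ h₂)
          (coshLaw_le_of_cos_le h₁ h₂
            (Real.cos_le_cos_of_nonneg_of_le_pi hα'0 hα1 (min_le_left _ _)))) _

theorem coshLaw_self (r φ : ℝ) : coshLaw r r φ = 1 + 2 * (Real.sinh r * Real.sin (φ / 2)) ^ 2 := by
  have h : Real.cos φ = 1 - 2 * Real.sin (φ / 2) ^ 2 := by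
    have := Real.cos_two_mul (φ / 2)
    have h2 := Real.sin_sq_add_cos_sq (φ / 2)
    rw [show 2 * (φ / 2) = φ by ring] at this
    linarith
  unfold coshLaw
  rw [h]
  have := Real.cosh_sq r
  linear_combination this

theorem cosh_eq_one_add (x : ℝ) : Real.cosh x = 1 + 2 * Real.sinh (x / 2) ^ 2 := by
  have := Real.cosh_two_mul (x / 2)
  have h2 := Real.cosh_sq (x / 2)
  rw [show 2 * (x / 2) = x by ring] at this
  linarith

theorem sinh_half_coneMetric_self (hr₀ : 0 < r₀) (hr : 0 ≤ r) (hℓ : 0 ≤ ℓ) :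
    Real.sinh (coneMetric r₀ r r ℓ / 2) =
      Real.sinh r * Real.sin (min Real.pi (ℓ / Real.sinh r₀) / 2) := by
  have hS := Real.sinh_pos_iff.2 hr₀
  have h := cosh_coneMetric (r₀ := r₀) (ℓ := ℓ) hr hr
  rw [coshLaw_self, cosh_eq_one_add] at h
  have h0 : 0 ≤ min Real.pi (ℓ / Real.sinh r₀) := le_min Real.pi_pos.le (by positivity)
  refine (sq_eq_sq₀ ?_ ?_).1 (by linarith)
  · exact Real.sinh_nonneg_iff.2 (by linarith [coneMetric_nonneg (r₀ := r₀) (ℓ := ℓ) hr hr])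
  · exact mul_nonneg (Real.sinh_nonneg_iff.2 hr) (Real.sin_nonneg_of_nonneg_of_le_pi (by linarith)
      (by linarith [min_le_left Real.pi (ℓ / Real.sinh r₀), Real.pi_pos]))

theorem coneMetric_self_le (hr₀ : 0 < r₀) (hr : 0 ≤ r) (hr' : r ≤ r₀) (hℓ : 0 ≤ ℓ) :
    coneMetric r₀ r r ℓ ≤ ℓ := by
  have hS := Real.sinh_pos_iff.2 hr₀
  have h0 : 0 ≤ min Real.pi (ℓ / Real.sinh r₀) := le_min Real.pi_pos.le (by positivity)
  have h1 : Real.sinh (coneMetric r₀ r r ℓ / 2) ≤ Real.sinh (ℓ / 2) := by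
    rw [sinh_half_coneMetric_self hr₀ hr hℓ]
    calc Real.sinh r * Real.sin (min Real.pi (ℓ / Real.sinh r₀) / 2)
        ≤ Real.sinh r * (min Real.pi (ℓ / Real.sinh r₀) / 2) := by
          gcongr
          exact Real.sin_le (by linarith)
      _ ≤ Real.sinh r₀ * ((ℓ / Real.sinh r₀) / 2) := by
          gcongr
          · exact Real.sinh_le_sinh.2 hr'
          · exact min_le_right _ _
      _ = ℓ / 2 := by field_simp
      _ ≤ Real.sinh (ℓ / 2) := Real.self_le_sinh_iff.2 (by linarith)
  linarith [Real.sinh_le_sinh.1 h1]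

/-- Moving the base point by `κ` at constant height `r' ≤ r₀` costs at most `κ`. This transfers
errors in the base to the cone without loss. -/
theorem coneMetric_le_add (hr₀ : 0 < r₀) (hr : 0 ≤ r) (hr' : 0 ≤ r') (hr'' : r' ≤ r₀) {ℓ' κ : ℝ}
    (hℓ : 0 ≤ ℓ) (hℓ' : 0 ≤ ℓ') (hκ : 0 ≤ κ) (h : ℓ' ≤ ℓ + κ) :
    coneMetric r₀ r r' ℓ' ≤ coneMetric r₀ r r' ℓ + κ :=
  (coneMetric_triangle hr₀ hr hr' hr' hℓ hκ hℓ' h).trans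
    (add_le_add_right (coneMetric_self_le hr₀ hr' hr'' hκ) _)

/-- A short chord of the boundary of a disc of radius `r₀` is almost as long as its arc. -/
theorem exists_le_mul_coneMetric (hr₀ : 0 < r₀) {κ : ℝ} (hκ : 0 < κ) :
    ∃ a > 0, 0 < coneMetric r₀ r₀ r₀ a ∧
      ∀ ℓ, 0 ≤ ℓ → ℓ ≤ a → ℓ ≤ (1 + κ) * coneMetric r₀ r₀ r₀ ℓ := by
  have hS := Real.sinh_pos_iff.2 hr₀
  have hc : Filter.Tendsto
      (fun a : ℝ => (1 + κ) * Real.cos (a / Real.sinh r₀ / 2) - Real.cosh (a / 2))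
      (nhdsWithin 0 (Set.Ioi 0)) (nhds ((1 + κ) * Real.cos (0 / Real.sinh r₀ / 2) -
        Real.cosh (0 / 2))) := by
    refine (Continuous.tendsto ?_ 0).mono_left nhdsWithin_le_nhds
    fun_prop
  -- The condition on `a` is `cosh (a/2) < (1 + κ) cos (a / (2 sinh r₀))`. Below, `u cos u ≤ sin u`
  -- and `sinh x ≤ x cosh x` turn `sinh (μ/2) = sinh r₀ sin u` into the wanted bound.
  have h1 := hc.eventually (lt_mem_nhds (a := 0) (by simpa using hκ))
  have h2 : ∀ᶠ a : ℝ in nhdsWithin 0 (Set.Ioi 0), a < Real.pi * Real.sinh r₀ :=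
    nhdsWithin_le_nhds (gt_mem_nhds (by have := Real.pi_pos; positivity))
  obtain ⟨a, ⟨ha1, ha2⟩, ha0⟩ := ((h1.and h2).and self_mem_nhdsWithin).exists
  have ha0 : 0 < a := ha0
  have hmin : ∀ ℓ, 0 ≤ ℓ → ℓ ≤ a → min Real.pi (ℓ / Real.sinh r₀) = ℓ / Real.sinh r₀ := by
    intro ℓ _ h
    exact min_eq_right ((div_le_iff₀ hS).2 (by linarith))
  have main : ∀ ℓ, 0 ≤ ℓ → ℓ ≤ a → ℓ ≤ (1 + κ) * coneMetric r₀ r₀ r₀ ℓ := by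
    intro ℓ hℓ0 hℓa
    have hs := sinh_half_coneMetric_self hr₀ hr₀.le hℓ0
    rw [hmin ℓ hℓ0 hℓa] at hs
    set μ := coneMetric r₀ r₀ r₀ ℓ with hμ
    have hμ0 : 0 ≤ μ := coneMetric_nonneg hr₀.le hr₀.le
    have hμℓ : μ ≤ ℓ := coneMetric_self_le hr₀ hr₀.le le_rfl hℓ0
    set u := ℓ / Real.sinh r₀ / 2 with hu
    have hu0 : 0 ≤ u := by positivity
    have huA : u ≤ a / Real.sinh r₀ / 2 := by rw [hu]; gcongr
    have hua : a / Real.sinh r₀ / 2 < Real.pi / 2 := by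
      have : a / Real.sinh r₀ < Real.pi := (div_lt_iff₀ hS).2 ha2
      linarith
    have hcosu : Real.cos (a / Real.sinh r₀ / 2) ≤ Real.cos u :=
      Real.cos_le_cos_of_nonneg_of_le_pi hu0 (by linarith [Real.pi_pos]) huA
    have hcosp : 0 < Real.cos u := Real.cos_pos_of_mem_Ioo ⟨by linarith [Real.pi_pos], by linarith⟩
    have htan : u * Real.cos u ≤ Real.sin u := by
      have := Real.le_tan hu0 (by linarith)
      rw [Real.tan_eq_sin_div_cos, le_div_iff₀ hcosp] at this
      exact this
    have hsinh : Real.sinh (μ / 2) ≤ μ / 2 * Real.cosh (a / 2) := by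
      have h3 : Real.sinh (μ / 2) ≤ μ / 2 * Real.cosh (μ / 2) := by
        have hd : MonotoneOn (fun x : ℝ => x * Real.cosh x - Real.sinh x) (Set.Ici 0) := by
          refine monotoneOn_of_deriv_nonneg (convex_Ici 0) (by fun_prop) (by fun_prop) ?_
          intro x hx
          rw [interior_Ici] at hx
          have : deriv (fun x : ℝ => x * Real.cosh x - Real.sinh x) x = x * Real.sinh x := by
            have h := (((hasDerivAt_id x).mul (Real.hasDerivAt_cosh x)).sub (Real.hasDerivAt_sinh x)).deriv
            have e : (fun x : ℝ => x * Real.cosh x - Real.sinh x) = (id * Real.cosh - Real.sinh) := by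
              ext; simp
            rw [e, h]; simp
          rw [this]
          exact mul_nonneg hx.le (Real.sinh_nonneg_iff.2 hx.le)
        have := hd (Set.self_mem_Ici) (show μ / 2 ∈ Set.Ici (0 : ℝ) from by simp; linarith)
          (by linarith)
        simp at this
        linarith
      refine h3.trans ?_
      gcongr
      rw [Real.cosh_le_cosh, abs_of_nonneg (by linarith), abs_of_nonneg (by linarith)]
      linarith
    have e1 : ℓ / 2 * Real.cos (a / Real.sinh r₀ / 2) ≤ μ / 2 * Real.cosh (a / 2) := by
      calc ℓ / 2 * Real.cos (a / Real.sinh r₀ / 2) ≤ ℓ / 2 * Real.cos u := by gcongr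
        _ = Real.sinh r₀ * (u * Real.cos u) := by rw [hu]; field_simp
        _ ≤ Real.sinh r₀ * Real.sin u := by gcongr
        _ ≤ _ := by rw [← hs]; exact hsinh
    have hca : 0 < Real.cos (a / Real.sinh r₀ / 2) :=
      Real.cos_pos_of_mem_Ioo ⟨by have : 0 < a / Real.sinh r₀ / 2 := by positivity
                                  linarith [Real.pi_pos], hua⟩
    have e2 : μ / 2 * Real.cosh (a / 2) ≤ μ / 2 * ((1 + κ) * Real.cos (a / Real.sinh r₀ / 2)) := by
      gcongr
      linarith
    have e3 : ℓ / 2 * Real.cos (a / Real.sinh r₀ / 2) ≤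
        (μ / 2 * (1 + κ)) * Real.cos (a / Real.sinh r₀ / 2) := by linarith
    have := le_of_mul_le_mul_right e3 hca
    linarith
  refine ⟨a, ha0, ?_, main⟩
  have := main a ha0.le le_rfl
  by_contra hneg
  have h4 := coneMetric_nonneg (r₀ := r₀) (ℓ := a) hr₀.le hr₀.le
  have h5 : coneMetric r₀ r₀ r₀ a = 0 := by linarith
  rw [h5] at this
  linarith

end

/-! ### Comparison with a geodesic of the hyperbolic plane -/

/-- `(ρ, ξ)` are the polar coordinates of the point at distance `σ` from the point `(rP, 0)` on
the hyperbolic geodesic of length `D` from `(rP, 0)` to `(rQ, θ)`. -/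
structure IsPlanarPoint (rP rQ θ D σ ρ ξ : ℝ) : Prop where
  cosh_eq : Real.cosh ρ * Real.sinh D =
    Real.cosh rP * Real.sinh (D - σ) + Real.cosh rQ * Real.sinh σ
  cos_eq : Real.sinh ρ * Real.cos ξ * Real.sinh D =
    Real.sinh rP * Real.sinh (D - σ) + Real.sinh rQ * Real.cos θ * Real.sinh σ
  sin_eq : Real.sinh ρ * Real.sin ξ * Real.sinh D = Real.sinh rQ * Real.sin θ * Real.sinh σ

/-- This is the reflection exchanging the rays of angles `0` and `θ`. It lets an estimate made from
the end `P` be used from the end `Q`. -/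
theorem IsPlanarPoint.symm {rP rQ θ D σ ρ ξ : ℝ} (h : IsPlanarPoint rP rQ θ D σ ρ ξ) :
    IsPlanarPoint rQ rP θ D (D - σ) ρ (θ - ξ) where
  cosh_eq := by rw [h.cosh_eq, sub_sub_cancel]; ring
  cos_eq := by
    rw [Real.cos_sub, sub_sub_cancel]
    have := Real.sin_sq_add_cos_sq θ
    linear_combination Real.cos θ * h.cos_eq + Real.sin θ * h.sin_eq +
      Real.sinh rQ * Real.sinh σ * this
  sin_eq := by
    rw [Real.sin_sub]
    linear_combination Real.sin θ * h.cos_eq - Real.cos θ * h.sin_eq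

/-- In the hyperboloid model the point is `(sinh (D - σ) P + sinh σ Q) / sinh D`, and `coshLaw` is
the Minkowski product of two vectors, hence linear in each. This is Stewart's formula. -/
theorem IsPlanarPoint.coshLaw_mul {rP rQ θ D σ ρ ξ : ℝ} (h : IsPlanarPoint rP rQ θ D σ ρ ξ)
    (r φ : ℝ) : coshLaw r ρ (φ - ξ) * Real.sinh D =
      coshLaw r rP φ * Real.sinh (D - σ) + coshLaw r rQ (φ - θ) * Real.sinh σ := by
  unfold coshLaw
  rw [Real.cos_sub, Real.cos_sub]
  linear_combination Real.cosh r * h.cosh_eq - Real.sinh r * Real.cos φ * h.cos_eq -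
    Real.sinh r * Real.sin φ * h.sin_eq

/-- The vector `(T, A, B)` lies on the hyperboloid `T² - A² - B² = 1` because `cosh D` is the
Minkowski product of the two ends. Its polar coordinates are `arcosh T` and the argument of `A +
iB`. The height stays below `r₀` since `sinh (D - σ) + sinh σ ≤ sinh D`. When `θ = π` the geodesic
lies on a line through the origin, whence `B = 0`. -/
theorem exists_isPlanarPoint {r₀ rP rQ θ D σ : ℝ} (hP : 0 ≤ rP) (hP' : rP ≤ r₀) (hQ : 0 ≤ rQ)
    (hQ' : rQ ≤ r₀) (hθ : 0 ≤ θ) (hθ' : θ ≤ Real.pi) (hD : 0 < D)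
    (hDc : Real.cosh D = coshLaw rP rQ θ) (hσ : 0 ≤ σ) (hσ' : σ ≤ D) :
    ∃ ρ ξ : ℝ, 0 ≤ ρ ∧ ρ ≤ r₀ ∧ 0 ≤ ξ ∧ ξ ≤ θ ∧ (θ = Real.pi → ξ = 0 ∨ ξ = Real.pi) ∧
      IsPlanarPoint rP rQ θ D σ ρ ξ := by
  have hS : 0 < Real.sinh D := Real.sinh_pos_iff.2 hD
  have hb : 0 ≤ Real.sinh (D - σ) := Real.sinh_nonneg_iff.2 (by linarith)
  have hs : 0 ≤ Real.sinh σ := Real.sinh_nonneg_iff.2 hσ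
  have hsP : 0 ≤ Real.sinh rP := Real.sinh_nonneg_iff.2 hP
  have hsQ : 0 ≤ Real.sinh rQ := Real.sinh_nonneg_iff.2 hQ
  have hDadd : Real.sinh D = Real.sinh (D - σ) * Real.cosh σ + Real.cosh (D - σ) * Real.sinh σ := by
    rw [← Real.sinh_add, sub_add_cancel]
  have hcadd : Real.cosh D = Real.cosh (D - σ) * Real.cosh σ + Real.sinh (D - σ) * Real.sinh σ := by
    rw [← Real.cosh_add, sub_add_cancel]
  have hsum : Real.sinh (D - σ) + Real.sinh σ ≤ Real.sinh D := by
    rw [hDadd]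
    nlinarith [Real.one_le_cosh σ, Real.one_le_cosh (D - σ)]
  set T := (Real.cosh rP * Real.sinh (D - σ) + Real.cosh rQ * Real.sinh σ) / Real.sinh D with hT
  set A := (Real.sinh rP * Real.sinh (D - σ) + Real.sinh rQ * Real.cos θ * Real.sinh σ) / Real.sinh D
    with hA
  set B := (Real.sinh rQ * Real.sin θ * Real.sinh σ) / Real.sinh D with hB
  have hT' : T * Real.sinh D = Real.cosh rP * Real.sinh (D - σ) + Real.cosh rQ * Real.sinh σ := by
    rw [hT]; field_simp
  have hA' : A * Real.sinh D =
      Real.sinh rP * Real.sinh (D - σ) + Real.sinh rQ * Real.cos θ * Real.sinh σ := by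
    rw [hA]; field_simp
  have hB' : B * Real.sinh D = Real.sinh rQ * Real.sin θ * Real.sinh σ := by
    rw [hB]; field_simp
  have hsinθ : 0 ≤ Real.sin θ := Real.sin_nonneg_of_nonneg_of_le_pi hθ hθ'
  have hB0 : 0 ≤ B := by positivity
  have hT0 : 0 ≤ T := by
    have := Real.cosh_pos rP
    have := Real.cosh_pos rQ
    positivity
  have hnorm : T ^ 2 - 1 = A ^ 2 + B ^ 2 := by
    have e : (T * Real.sinh D) ^ 2 - (A * Real.sinh D) ^ 2 - (B * Real.sinh D) ^ 2 =
        Real.sinh D ^ 2 := by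
      rw [hT', hA', hB']
      have c1 := Real.cosh_sq rP
      have c2 := Real.cosh_sq rQ
      have c3 := Real.sin_sq_add_cos_sq θ
      have c4 := Real.cosh_sq σ
      have c5 := Real.cosh_sq (D - σ)
      have c6 : Real.cosh rP * Real.cosh rQ - Real.sinh rP * Real.sinh rQ * Real.cos θ =
          Real.cosh (D - σ) * Real.cosh σ + Real.sinh (D - σ) * Real.sinh σ := by
        rw [← hcadd, hDc]; rfl
      rw [hDadd]
      generalize Real.sinh (D - σ) = b at *
      generalize Real.cosh (D - σ) = b' at *
      generalize Real.sinh σ = s at *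
      generalize Real.cosh σ = s' at *
      linear_combination b ^ 2 * c1 + s ^ 2 * c2 - s ^ 2 * Real.sinh rQ ^ 2 * c3 +
        2 * b * s * c6 - b ^ 2 * c4 - s ^ 2 * c5
    have : (T ^ 2 - A ^ 2 - B ^ 2 - 1) * Real.sinh D ^ 2 = 0 := by linear_combination e
    have := (mul_eq_zero.1 this).resolve_right (by positivity)
    linarith
  have hT1 : 1 ≤ T := by nlinarith [sq_nonneg A, sq_nonneg B]
  have hTr : T ≤ Real.cosh r₀ := by
    have hcP : Real.cosh rP ≤ Real.cosh r₀ := by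
      rw [Real.cosh_le_cosh, abs_of_nonneg hP]; exact hP'.trans (le_abs_self _)
    have hcQ : Real.cosh rQ ≤ Real.cosh r₀ := by
      rw [Real.cosh_le_cosh, abs_of_nonneg hQ]; exact hQ'.trans (le_abs_self _)
    have hcpos := Real.cosh_pos r₀
    have : T * Real.sinh D ≤ Real.cosh r₀ * Real.sinh D := by
      rw [hT']
      nlinarith [mul_le_mul_of_nonneg_right hcP hb, mul_le_mul_of_nonneg_right hcQ hs,
        mul_le_mul_of_nonneg_left hsum hcpos.le]
    exact le_of_mul_le_mul_right this hS
  have hρ0 : 0 ≤ Real.arcosh T := Real.arcosh_nonneg hT1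
  have hρc : Real.cosh (Real.arcosh T) = T := Real.cosh_arcosh hT1
  set z : ℂ := ⟨A, B⟩ with hz
  have hnz : Real.sinh (Real.arcosh T) = ‖z‖ := by
    rw [Real.sinh_arcosh hT1, hnorm, Complex.norm_eq_sqrt_sq_add_sq]
  have hcos : Real.sinh (Real.arcosh T) * Real.cos (Complex.arg z) = A := by
    rw [hnz, Complex.norm_mul_cos_arg]
  have hsin : Real.sinh (Real.arcosh T) * Real.sin (Complex.arg z) = B := by
    rw [hnz, Complex.norm_mul_sin_arg]
  have hξ0 : 0 ≤ Complex.arg z := Complex.arg_nonneg_iff.2 hB0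
  have hξpi : Complex.arg z ≤ Real.pi := Complex.arg_le_pi z
  refine ⟨Real.arcosh T, Complex.arg z, hρ0, ?_, hξ0, ?_, ?_, ?_⟩
  · exact le_of_cosh_le_cosh (hP.trans hP') (by rw [hρc]; exact hTr)
  · by_contra hlt
    push Not at hlt
    -- For `θ > 0` the sign of `sin (θ - ξ)` decides. For `θ = 0` the difference could be `-π`,
    -- where the sine vanishes, so this case is treated apart.
    rcases hθ.eq_or_lt with h0 | h0
    · have hA0 : 0 ≤ A := by
        rw [hA, ← h0, Real.cos_zero]; positivity
      have hB0 : B = 0 := by rw [hB, ← h0, Real.sin_zero]; simp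
      have : z = ((A : ℝ) : ℂ) := by rw [hz, hB0]; rfl
      rw [this, Complex.arg_ofReal_of_nonneg hA0] at hlt
      linarith
    · have hneg : Real.sin (θ - Complex.arg z) < 0 :=
        Real.sin_neg_of_neg_of_neg_pi_lt (by linarith) (by linarith)
      have hval : ‖z‖ * Real.sin (θ - Complex.arg z) * Real.sinh D =
          Real.sin θ * Real.sinh rP * Real.sinh (D - σ) := by
        rw [Real.sin_sub]
        rw [hnz] at hcos hsin
        linear_combination Real.sinh D * Real.sin θ * hcos - Real.sinh D * Real.cos θ * hsin +
          Real.sin θ * hA' - Real.cos θ * hB'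
      have hnn : 0 ≤ ‖z‖ * Real.sin (θ - Complex.arg z) * Real.sinh D := by
        rw [hval]; positivity
      have hz0 : z ≠ 0 := by
        rintro h
        rw [h, Complex.arg_zero] at hlt
        linarith
      have hzp : 0 < ‖z‖ := norm_pos_iff.2 hz0
      have : ‖z‖ * Real.sin (θ - Complex.arg z) * Real.sinh D < 0 :=
        mul_neg_of_neg_of_pos (mul_neg_of_pos_of_neg hzp hneg) hS
      linarith
  · intro hpi
    have hB0 : B = 0 := by rw [hB, hpi, Real.sin_pi]; simp
    have : z = ((A : ℝ) : ℂ) := by rw [hz, hB0]; rfl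
    rcases le_or_gt 0 A with h | h
    · left; rw [this, Complex.arg_ofReal_of_nonneg h]
    · right; rw [this, Complex.arg_ofReal_of_neg h]
  · exact ⟨by rw [hρc, hT'], by rw [hcos, hA'], by rw [hsin, hB']⟩

/-- Bounding `a` by `m + σ` and `c` by `m + (D - σ)`, the right-hand side becomes `cosh m sinh D + 2
sinh m sinh (D - σ) sinh σ`. As `2 sinh (D - σ) sinh σ ≤ sinh D`, this is at most `exp m * sinh D`.
-/
theorem le_exp_of_mul_sinh_le {D σ a c m Z : ℝ} (hD : 0 < D) (hσ : 0 ≤ σ) (hσ' : σ ≤ D)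
    (ha : 0 ≤ a) (hc : 0 ≤ c) (hac : D ≤ a + c) (ham : a ≤ m + σ) (hcm : c ≤ m + (D - σ))
    (h : Z * Real.sinh D ≤ Real.cosh a * Real.sinh (D - σ) + Real.cosh c * Real.sinh σ) :
    Z ≤ Real.exp m := by
  have hm : 0 ≤ m := by linarith
  have hS : 0 < Real.sinh D := Real.sinh_pos_iff.2 hD
  have hb : 0 ≤ Real.sinh (D - σ) := Real.sinh_nonneg_iff.2 (by linarith)
  have hs : 0 ≤ Real.sinh σ := Real.sinh_nonneg_iff.2 hσ
  have hsm : 0 ≤ Real.sinh m := Real.sinh_nonneg_iff.2 hm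
  have h1 : Real.cosh a ≤ Real.cosh (m + σ) := by
    rw [Real.cosh_le_cosh, abs_of_nonneg ha]; exact ham.trans (le_abs_self _)
  have h2 : Real.cosh c ≤ Real.cosh (m + (D - σ)) := by
    rw [Real.cosh_le_cosh, abs_of_nonneg hc]; exact hcm.trans (le_abs_self _)
  have hDadd : Real.sinh D = Real.sinh (D - σ) * Real.cosh σ + Real.cosh (D - σ) * Real.sinh σ := by
    rw [← Real.sinh_add, sub_add_cancel]
  have h3 : 2 * (Real.sinh (D - σ) * Real.sinh σ) ≤ Real.sinh D := by
    rw [hDadd]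
    nlinarith [mul_le_mul_of_nonneg_left (Real.sinh_lt_cosh σ).le hb,
      mul_le_mul_of_nonneg_right (Real.sinh_lt_cosh (D - σ)).le hs]
  have h4 : Z * Real.sinh D ≤ Real.exp m * Real.sinh D := by
    calc Z * Real.sinh D ≤ Real.cosh a * Real.sinh (D - σ) + Real.cosh c * Real.sinh σ := h
      _ ≤ Real.cosh (m + σ) * Real.sinh (D - σ) + Real.cosh (m + (D - σ)) * Real.sinh σ := by
          gcongr
      _ = Real.cosh m * Real.sinh D + Real.sinh m * (2 * (Real.sinh (D - σ) * Real.sinh σ)) := by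
          rw [Real.cosh_add, Real.cosh_add, hDadd]; ring
      _ ≤ Real.cosh m * Real.sinh D + Real.sinh m * Real.sinh D := by gcongr
      _ = Real.exp m * Real.sinh D := by rw [← Real.cosh_add_sinh]; ring
  exact le_of_mul_le_mul_right h4 hS

theorem le_add_log_two_of_cosh_le_exp {w m : ℝ} (h : Real.cosh w ≤ Real.exp m) :
    w ≤ m + Real.log 2 := by
  have h1 : Real.exp w / 2 ≤ Real.cosh w := by
    rw [Real.cosh_eq]
    have := Real.exp_pos (-w)
    linarith
  have h2 : Real.exp w ≤ Real.exp (m + Real.log 2) := by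
    rw [Real.exp_add, Real.exp_log two_pos]
    linarith
  exact Real.exp_le_exp.1 h2

/-- Comparison of a point of a cone with a point `(ρ, ξ)` of the hyperbolic geodesic between two
points at heights `rP`, `rQ`; here `ℓP`, `ℓQ`, `ℓ` are the lengths of the sides of a triangle in
the base. -/
theorem coneMetric_planarPoint_le {r₀ rP rQ D σ ρ ξ h ℓ ℓP ℓQ : ℝ} (hr₀ : 0 < r₀)
    (hP : 0 ≤ rP) (hQ : 0 ≤ rQ) (hh : 0 ≤ h) (hρ : 0 ≤ ρ) (hℓ : 0 ≤ ℓ) (hℓP : 0 ≤ ℓP)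
    (hℓQ : 0 ≤ ℓQ) (hD : 0 < D) (hDc : D = coneMetric r₀ rP rQ ℓ) (hσ : 0 ≤ σ) (hσ' : σ ≤ D)
    (hξ : 0 ≤ ξ) (hξ' : ξ ≤ min Real.pi (ℓ / Real.sinh r₀))
    (hpt : IsPlanarPoint rP rQ (min Real.pi (ℓ / Real.sinh r₀)) D σ ρ ξ)
    (hcase : ℓ / Real.sinh r₀ ≤ Real.pi ∨ ξ = 0)
    (h1 : ℓP ≤ ℓQ + ℓ) (h2 : ℓ ≤ ℓP + ℓQ) :
    coneMetric r₀ h ρ |ℓP - ξ * Real.sinh r₀| ≤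
      max (coneMetric r₀ h rP ℓP - σ) (coneMetric r₀ h rQ ℓQ - (D - σ)) + Real.log 2 := by
  have hS := Real.sinh_pos_iff.2 hr₀
  have hpi := Real.pi_pos
  set S := Real.sinh r₀ with hSdef
  set θ := min Real.pi (ℓ / S) with hθ
  have hθpi : θ ≤ Real.pi := min_le_left _ _
  have hθℓ : θ ≤ ℓ / S := min_le_right _ _
  set φ := ℓP / S with hφ
  have hφ0 : 0 ≤ φ := by positivity
  set ψ := ℓQ / S with hψ
  have hψ1 : φ ≤ ψ + ℓ / S := by rw [hφ, hψ, ← add_div]; gcongr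
  have hψ2 : ℓ / S ≤ φ + ψ := by rw [hφ, hψ, ← add_div]; gcongr
  -- The truncation makes `φ' - ξ` have exactly the cosine of the capped angle to the planar point.
  -- The cosines of the angles to both ends can only increase, so Stewart's formula at `φ'` bounds
  -- the true distances in the right direction.
  set φ' := min φ (Real.pi + ξ) with hφ'
  have hφ'0 : 0 ≤ φ' := le_min hφ0 (by linarith)
  have hφ'1 : φ' ≤ φ := min_le_left _ _
  have hφ'2 : φ' ≤ Real.pi + ξ := min_le_right _ _
  have hcos1 : Real.cos (min Real.pi (|ℓP - ξ * S| / S)) = Real.cos (φ' - ξ) := by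
    have e : |ℓP - ξ * S| / S = |φ - ξ| := by
      rw [hφ, ← abs_of_pos hS, ← abs_div, abs_of_pos hS]
      congr 1
      field_simp
    rw [e]
    rcases le_total φ (Real.pi + ξ) with hle | hle
    · rw [hφ', min_eq_left hle, min_eq_right, Real.cos_abs]
      rw [abs_le]; constructor <;> linarith
    · rw [hφ', min_eq_right hle, add_sub_cancel_right, min_eq_left]
      exact le_trans (by linarith) (le_abs_self _)
  have hcos2 : Real.cos (min Real.pi φ) ≤ Real.cos φ' := by
    rcases le_total φ Real.pi with hle | hle
    · rw [min_eq_right hle, hφ', min_eq_left (by linarith)]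
    · rw [min_eq_left hle, Real.cos_pi]; exact Real.neg_one_le_cos _
  have hcos3 : Real.cos (min Real.pi ψ) ≤ Real.cos (φ' - θ) := by
    rw [← Real.cos_abs (φ' - θ)]
    refine Real.cos_le_cos_of_nonneg_of_le_pi (abs_nonneg _) (min_le_left _ _) (le_min ?_ ?_)
    · rw [abs_le]; constructor <;> linarith
    · rw [abs_le]
      constructor
      · rcases le_total φ (Real.pi + ξ) with hle | hle
        · rw [hφ', min_eq_left hle]; linarith
        · rw [hφ', min_eq_right hle]
          have : 0 ≤ ψ := by positivity
          linarith
      · rcases hcase with hc | hc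
        · have : θ = ℓ / S := min_eq_right hc
          linarith
        · have : 0 ≤ ψ := by positivity
          rcases le_total Real.pi (ℓ / S) with hc' | hc'
          · have : θ = Real.pi := min_eq_left hc'
            linarith
          · have : θ = ℓ / S := min_eq_right hc'
            linarith
  set a := coneMetric r₀ h rP ℓP with ha
  set c := coneMetric r₀ h rQ ℓQ with hc
  set m := max (a - σ) (c - (D - σ)) with hm
  refine le_add_log_two_of_cosh_le_exp ?_
  rw [cosh_coneMetric hh hρ]
  have ha0 : 0 ≤ a := coneMetric_nonneg hh hP
  have hc0 : 0 ≤ c := coneMetric_nonneg hh hQ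
  refine le_exp_of_mul_sinh_le hD hσ hσ' ha0 hc0 ?_ (m := m)
    (by linarith [le_max_left (a - σ) (c - (D - σ))])
    (by linarith [le_max_right (a - σ) (c - (D - σ))]) ?_
  · rw [hDc, ha, hc, coneMetric_comm _ h]
    exact coneMetric_triangle hr₀ hP hh hQ hℓP hℓQ hℓ h2
  · have e1 : coshLaw h ρ (min Real.pi (|ℓP - ξ * S| / S)) = coshLaw h ρ (φ' - ξ) := by
      unfold coshLaw; rw [hcos1]
    rw [e1, hpt.coshLaw_mul]
    have hb : 0 ≤ Real.sinh (D - σ) := Real.sinh_nonneg_iff.2 (by linarith)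
    have hs : 0 ≤ Real.sinh σ := Real.sinh_nonneg_iff.2 hσ
    gcongr
    · rw [ha, cosh_coneMetric hh hP]
      exact coshLaw_le_of_cos_le hh hP hcos2
    · rw [hc, cosh_coneMetric hh hQ]
      exact coshLaw_le_of_cos_le hh hQ hcos3

/-! ### Coordinates on the cone -/

/-- The distance to the vertex. -/
def Cone.height {r₀ : ℝ} {Z : Type*} : Cone r₀ Z → ℝ :=
  Quotient.lift (fun p : Z × Set.Icc (0 : ℝ) r₀ => (p.2 : ℝ)) (by
    rintro p q (rfl | ⟨h1, h2⟩)
    · rfl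
    · exact h1.trans h2.symm)

open Classical in
/-- The base point of a point of the cone; an arbitrary point for the vertex. -/
def Cone.base {r₀ : ℝ} {Z : Type*} : Cone r₀ Z → Z :=
  Quotient.lift (fun p : Z × Set.Icc (0 : ℝ) r₀ =>
    if (p.2 : ℝ) = 0 then Classical.choice ⟨p.1⟩ else p.1) (by
    rintro p q (rfl | ⟨h1, h2⟩)
    · rfl
    · simp [h1, h2])

/-- The point `(y, r₀)`. -/
def Cone.top {r₀ : ℝ} {Z : Type*} (hr₀ : 0 < r₀) (y : Z) : Cone r₀ Z :=
  Cone.mk y ⟨r₀, hr₀.le, le_rfl⟩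

section

variable {r₀ : ℝ} {Z : Type*}

@[simp] theorem Cone.height_mk (y : Z) (r : Set.Icc (0 : ℝ) r₀) : (Cone.mk y r).height = r := rfl

theorem Cone.base_mk (y : Z) (r : Set.Icc (0 : ℝ) r₀) (h : (r : ℝ) ≠ 0) :
    (Cone.mk y r).base = y := by
  change (if (r : ℝ) = 0 then _ else y) = y
  simp [h]

theorem Cone.height_nonneg (u : Cone r₀ Z) : 0 ≤ u.height := by
  induction u using Quotient.inductionOn with
  | _ p => exact p.2.2.1

theorem Cone.height_le (u : Cone r₀ Z) : u.height ≤ r₀ := by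
  induction u using Quotient.inductionOn with
  | _ p => exact p.2.2.2

@[simp] theorem Cone.height_top (hr₀ : 0 < r₀) (y : Z) : (Cone.top hr₀ y).height = r₀ := rfl

@[simp] theorem Cone.base_top (hr₀ : 0 < r₀) (y : Z) : (Cone.top hr₀ y).base = y :=
  Cone.base_mk _ _ hr₀.ne'

theorem Cone.eq_top (hr₀ : 0 < r₀) (u : Cone r₀ Z) (h : u.height = r₀) :
    u = Cone.top hr₀ u.base := by
  induction u using Quotient.inductionOn with
  | _ p =>
    obtain ⟨y, r⟩ := p
    have hr : (r : ℝ) = r₀ := h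
    change Cone.mk y r = Cone.top hr₀ (Cone.mk y r).base
    rw [Cone.base_mk _ _ (by rw [hr]; exact hr₀.ne')]
    congr 1
    exact Subtype.ext hr

variable [PseudoMetricSpace Z]

theorem Cone.distance_eq (u v : Cone r₀ Z) :
    Cone.distance u v = coneMetric r₀ u.height v.height (dist u.base v.base) := by
  induction u using Quotient.inductionOn with
  | _ p =>
  induction v using Quotient.inductionOn with
  | _ q =>
  obtain ⟨y, r⟩ := p
  obtain ⟨y', r'⟩ := q
  change Real.arcosh (Real.cosh r * Real.cosh r' -
    Real.sinh r * Real.sinh r' * Real.cos (coneAngle r₀ y y')) =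
      coneMetric r₀ r r' (dist (Cone.mk y r).base (Cone.mk y' r').base)
  unfold coneMetric coshLaw coneAngle
  by_cases h : (r : ℝ) = 0
  · simp [h]
  by_cases h' : (r' : ℝ) = 0
  · simp [h']
  rw [Cone.base_mk _ _ h, Cone.base_mk _ _ h']

theorem Cone.distance_self (u : Cone r₀ Z) : Cone.distance u u = 0 := by
  rw [Cone.distance_eq, dist_self, coneMetric_zero, sub_self, abs_zero]

theorem Cone.distance_nonneg (u v : Cone r₀ Z) : 0 ≤ Cone.distance u v := by
  rw [Cone.distance_eq]
  exact coneMetric_nonneg u.height_nonneg v.height_nonneg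

theorem Cone.distance_triangle (hr₀ : 0 < r₀) (u v w : Cone r₀ Z) :
    Cone.distance u w ≤ Cone.distance u v + Cone.distance v w := by
  simp only [Cone.distance_eq]
  exact coneMetric_triangle hr₀ u.height_nonneg v.height_nonneg w.height_nonneg dist_nonneg
    dist_nonneg dist_nonneg (dist_triangle _ _ _)

theorem Cone.distance_top_top (hr₀ : 0 < r₀) (y y' : Z) :
    Cone.distance (Cone.top hr₀ y) (Cone.top hr₀ y') = coneMetric r₀ r₀ r₀ (dist y y') := by
  simp [Cone.distance_eq]

theorem Cone.distance_top_top_le (hr₀ : 0 < r₀) (y y' : Z) :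
    Cone.distance (Cone.top hr₀ y) (Cone.top hr₀ y') ≤ dist y y' := by
  rw [Cone.distance_top_top]
  exact coneMetric_self_le hr₀ hr₀.le le_rfl dist_nonneg

end

/-! ### Four-point inequality in the form used below -/

theorem IsGromovHyperbolic.four_point {X : Type*} [PseudoMetricSpace X] {δ : ℝ}
    (h : IsGromovHyperbolic X δ) (x y z w : X) :
    dist x y + dist z w ≤ max (dist x z + dist y w) (dist x w + dist y z) + 2 * δ := by
  have := h x z y w
  unfold gromovProduct at this
  rcases min_le_iff.1 (show min _ _ ≤ _ from (sub_le_iff_le_add.1 this)) with h1 | h1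
  · refine le_trans ?_ (add_le_add_left (le_max_left _ _) _)
    rw [dist_comm w x, dist_comm w y, dist_comm w z] at h1
    rw [dist_comm z w]
    rw [dist_comm w z, dist_comm y w]
    linarith [dist_comm y w]
  · refine le_trans ?_ (add_le_add_left (le_max_right _ _) _)
    rw [dist_comm w x, dist_comm w y, dist_comm w z] at h1
    linarith [dist_comm z y, dist_comm z w]

/-- The points of `Y` follow the geodesics between the points of `Y` up to `K`. -/
def IsCoarselyConvex {X : Type*} [PseudoMetricSpace X] (K : ℝ) (Y : Set X) : Prop :=
  ∀ p ∈ Y, ∀ q ∈ Y, ∀ τ ∈ Set.Icc 0 (dist p q),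
    ∃ w ∈ Y, |dist p w - τ| ≤ K ∧ |dist w q - (dist p q - τ)| ≤ K

/-- Coarse `CAT(-1)` comparison in the cone over a coarsely convex subset of a hyperbolic
space. -/
theorem Cone.exists_comparison_point {X : Type*} [PseudoMetricSpace X] {r₀ K : ℝ} (hr₀ : 0 < r₀)
    (hK : 0 ≤ K) {Y : Set X} (hX : IsGromovHyperbolic X K) (hY : IsCoarselyConvex K Y)
    (P Q : Cone r₀ Y) {σ : ℝ} (hσ : 0 ≤ σ) (hσ' : σ ≤ Cone.distance P Q) :
    ∃ v : Cone r₀ Y, ∀ R : Cone r₀ Y, Cone.distance R v ≤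
      max (Cone.distance R P - σ) (Cone.distance R Q - (Cone.distance P Q - σ)) +
        Real.log 2 + 3 * K := by
  have hlog : 0 < Real.log 2 := Real.log_pos one_lt_two
  have hS := Real.sinh_pos_iff.2 hr₀
  rcases (hσ.trans hσ').eq_or_lt with hD | hD
  · refine ⟨P, fun R => ?_⟩
    have : σ = 0 := le_antisymm (by rw [hD]; exact hσ') hσ
    have h := le_max_left (Cone.distance R P - σ) (Cone.distance R Q - (Cone.distance P Q - σ))
    linarith
  set D := Cone.distance P Q with hDdef
  set ℓ := dist P.base Q.base with hℓ
  have hDc : D = coneMetric r₀ P.height Q.height ℓ := Cone.distance_eq _ _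
  set θ := min Real.pi (ℓ / Real.sinh r₀) with hθ
  have hℓ0 : 0 ≤ ℓ := dist_nonneg
  have hθ0 : 0 ≤ θ := le_min Real.pi_pos.le (by positivity)
  obtain ⟨ρ, ξ, hρ, hρ', hξ, hξ', hξpi, hpt⟩ := exists_isPlanarPoint P.height_nonneg P.height_le
    Q.height_nonneg Q.height_le hθ0 (min_le_left _ _) hD
    (by rw [hDc, cosh_coneMetric P.height_nonneg Q.height_nonneg]) hσ hσ'
  -- It suffices that the base of `R` be no farther from `w` than `ξ sinh r₀` subtracted from its
  -- distance to the base of `P`, up to `3 * K`; `sideQ` is the same condition seen from `Q`. The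
  -- point `w` must not depend on `R`, but the side used may.
  have sideP : ∀ (w : Y) (R : Cone r₀ Y), (ℓ / Real.sinh r₀ ≤ Real.pi ∨ ξ = 0) →
      dist R.base w ≤ dist R.base P.base - ξ * Real.sinh r₀ + 3 * K →
      Cone.distance R (Cone.mk w ⟨ρ, hρ, hρ'⟩) ≤
        max (Cone.distance R P - σ) (Cone.distance R Q - (D - σ)) + Real.log 2 + 3 * K := by
    intro w R hc hw
    have h := coneMetric_planarPoint_le hr₀ P.height_nonneg Q.height_nonneg R.height_nonneg hρ hℓ0
      (dist_nonneg (x := R.base) (y := P.base)) (dist_nonneg (x := R.base) (y := Q.base)) hD hDc hσ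
      hσ' hξ hξ' hpt hc
      (by have := dist_triangle R.base Q.base P.base
          rw [dist_comm Q.base] at this; exact this)
      (by have := dist_triangle P.base R.base Q.base
          rw [dist_comm P.base R.base] at this; exact this)
    rw [← Cone.distance_eq, ← Cone.distance_eq] at h
    have e : Cone.distance R (Cone.mk w ⟨ρ, hρ, hρ'⟩) = coneMetric r₀ R.height ρ (dist R.base w) := by
      rw [Cone.distance_eq, Cone.height_mk]
      by_cases h0 : ρ = 0
      · subst h0; unfold coneMetric coshLaw; simp
      · rw [Cone.base_mk _ _ h0]
    rw [e]
    refine (coneMetric_le_add hr₀ R.height_nonneg hρ hρ' (abs_nonneg _) dist_nonneg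
      (by positivity : 0 ≤ 3 * K) (hw.trans (add_le_add_left (le_abs_self _) _))).trans ?_
    linarith
  have hpt' := hpt.symm
  have sideQ : ∀ (w : Y) (R : Cone r₀ Y), (ℓ / Real.sinh r₀ ≤ Real.pi ∨ θ - ξ = 0) →
      dist R.base w ≤ dist R.base Q.base - (θ - ξ) * Real.sinh r₀ + 3 * K →
      Cone.distance R (Cone.mk w ⟨ρ, hρ, hρ'⟩) ≤
        max (Cone.distance R P - σ) (Cone.distance R Q - (D - σ)) + Real.log 2 + 3 * K := by
    intro w R hc hw
    have h := coneMetric_planarPoint_le hr₀ Q.height_nonneg P.height_nonneg R.height_nonneg hρ hℓ0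
      (dist_nonneg (x := R.base) (y := Q.base)) (dist_nonneg (x := R.base) (y := P.base)) hD
      (by rw [hDc, coneMetric_comm]) (by linarith : 0 ≤ D - σ) (by linarith)
      (by linarith : 0 ≤ θ - ξ) (by linarith) hpt' hc
      (by have := dist_triangle R.base P.base Q.base; exact this)
      (by have := dist_triangle P.base R.base Q.base
          rw [dist_comm P.base R.base] at this; linarith)
    rw [← Cone.distance_eq, ← Cone.distance_eq, sub_sub_cancel, max_comm] at h
    have e : Cone.distance R (Cone.mk w ⟨ρ, hρ, hρ'⟩) = coneMetric r₀ R.height ρ (dist R.base w) := by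
      rw [Cone.distance_eq, Cone.height_mk]
      by_cases h0 : ρ = 0
      · subst h0; unfold coneMetric coshLaw; simp
      · rw [Cone.base_mk _ _ h0]
    rw [e]
    refine (coneMetric_le_add hr₀ R.height_nonneg hρ hρ' (abs_nonneg _) dist_nonneg
      (by positivity : 0 ≤ 3 * K) (hw.trans (add_le_add_left (le_abs_self _) _))).trans ?_
    linarith
  rcases le_or_gt (ℓ / Real.sinh r₀) Real.pi with hle | hgt
  · have hθℓ : θ = ℓ / Real.sinh r₀ := min_eq_right hle
    have hθS : θ * Real.sinh r₀ = ℓ := by rw [hθℓ]; field_simp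
    have hτ : ξ * Real.sinh r₀ ≤ ℓ := by rw [← hθS]; gcongr
    obtain ⟨w, hwY, hw1, hw2⟩ := hY P.base P.base.2 Q.base Q.base.2 (ξ * Real.sinh r₀)
      ⟨by positivity, hτ⟩
    refine ⟨Cone.mk ⟨w, hwY⟩ ⟨ρ, hρ, hρ'⟩, fun R => ?_⟩
    -- The base is almost a tree and `w` is almost between the ends, so every third base point sees
    -- `w` in line with one of them. The error is `2 * K` from hyperbolicity and `K` from the
    -- position of `w`.
    have h4 := hX.four_point (R.base : X) w P.base Q.base
    have e : dist (P.base : X) Q.base = ℓ := rfl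
    rw [e] at h4 hw2
    have a1 := abs_le.1 hw1
    have a2 := abs_le.1 hw2
    rcases le_total (dist (R.base : X) P.base + dist w Q.base)
      (dist (R.base : X) Q.base + dist w P.base) with hm | hm
    · rw [max_eq_right hm, dist_comm w (P.base : X)] at h4
      refine sideQ ⟨w, hwY⟩ R (Or.inl hle) ?_
      rw [sub_mul, hθS]
      change dist (R.base : X) w ≤ dist (R.base : X) Q.base - _ + _
      linarith
    · rw [max_eq_left hm] at h4
      refine sideP ⟨w, hwY⟩ R (Or.inl hle) ?_
      change dist (R.base : X) w ≤ dist (R.base : X) P.base - _ + _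
      linarith
  -- The geodesic passes through the vertex, so the comparison point lies on the ray of one of the
  -- two ends and no point of the base in between is needed.
  · have hθpi : θ = Real.pi := min_eq_left hgt.le
    rcases hξpi hθpi with h0 | h0
    · refine ⟨Cone.mk P.base ⟨ρ, hρ, hρ'⟩, fun R => sideP _ R (Or.inr h0) ?_⟩
      rw [h0]; linarith
    · refine ⟨Cone.mk Q.base ⟨ρ, hρ, hρ'⟩, fun R => sideQ _ R (Or.inr (by linarith)) ?_⟩
      rw [h0, hθpi]; linarith

/-! ### Quasi-convex subsets of a hyperbolic space -/

section

variable {X I : Type*} [PseudoMetricSpace X] {δ : ℝ}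

theorem IsGromovHyperbolic.mono {δ' : ℝ} (h : IsGromovHyperbolic X δ) (hδ : δ ≤ δ') :
    IsGromovHyperbolic X δ' := fun x y z t => le_trans (by linarith) (h x y z t)

theorem IsGeodesicSpace.exists_point (hX : IsGeodesicSpace X) (x x' : X) {τ : ℝ}
    (hτ : τ ∈ Set.Icc 0 (dist x x')) :
    ∃ m, dist x m = τ ∧ dist m x' = dist x x' - τ := by
  obtain ⟨γ, h0, h1, h⟩ := hX x x'
  refine ⟨γ τ, ?_, ?_⟩
  · have := h 0 ⟨le_rfl, dist_nonneg⟩ τ hτ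
    rw [h0, zero_sub, abs_neg, abs_of_nonneg hτ.1] at this
    exact this
  · have := h τ hτ (dist x x') ⟨dist_nonneg, le_rfl⟩
    rw [h1, abs_sub_comm, abs_of_nonneg (by linarith [hτ.2])] at this
    exact this

theorem IsQuasiConvex.exists_point (hX : IsGeodesicSpace X) {α : ℝ} {Y : Set X}
    (hY : IsQuasiConvex α Y) {x x' : X} (hx : x ∈ Y) (hx' : x' ∈ Y) {τ : ℝ}
    (hτ : τ ∈ Set.Icc 0 (dist x x')) :
    ∃ m ∈ Metric.cthickening α Y, dist x m = τ ∧ dist m x' = dist x x' - τ := by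
  obtain ⟨γ, h0, h1, h⟩ := hX x x'
  refine ⟨γ τ, hY x hx x' hx' γ ⟨h0, h1, h⟩ τ hτ, ?_, ?_⟩
  · have := h 0 ⟨le_rfl, dist_nonneg⟩ τ hτ
    rw [h0, zero_sub, abs_neg, abs_of_nonneg hτ.1] at this
    exact this
  · have := h τ hτ (dist x x') ⟨dist_nonneg, le_rfl⟩
    rw [h1, abs_sub_comm, abs_of_nonneg (by linarith [hτ.2])] at this
    exact this

theorem exists_dist_lt_of_mem_cthickening {α β : ℝ} {Y : Set X} {m : X}
    (hm : m ∈ Metric.cthickening α Y) (hβ : 0 < β) (h : α < β) : ∃ y ∈ Y, dist m y < β :=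
  Metric.mem_thickening_iff.1 (Metric.cthickening_subset_thickening' hβ h _ hm)

theorem IsQuasiConvex.isCoarselyConvex (hδ : 0 < δ) (hX : IsGeodesicSpace X) {Y : Set X}
    (hY : IsQuasiConvex (10 * δ) Y) {K : ℝ} (hK : 11 * δ ≤ K) : IsCoarselyConvex K Y := by
  intro p hp q hq τ hτ
  obtain ⟨m, hm, h1, h2⟩ := hY.exists_point hX hp hq hτ
  -- The thickening only bounds an infimum; the extra `δ` provides an actual point of `Y`.
  obtain ⟨w, hw, hmw⟩ := exists_dist_lt_of_mem_cthickening hm (by linarith)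
    (show 10 * δ < 11 * δ by linarith)
  refine ⟨w, hw, ?_, ?_⟩
  · rw [abs_le]
    constructor <;> linarith [dist_triangle p m w, dist_triangle p w m, dist_comm m w]
  · rw [abs_le]
    constructor <;> linarith [dist_triangle m w q, dist_triangle w m q, dist_comm m w]

/-- Points at the same distance from `t` on two sides of a triangle, before the sides diverge. -/
theorem IsGromovHyperbolic.dist_le_of_tripod (hX : IsGromovHyperbolic X δ) (hδ : 0 ≤ δ)
    {t x y u v : X} {s : ℝ} (hu : dist t u = s) (hu' : dist u x = dist t x - s)
    (hv : dist t v = s) (hv' : dist v y = dist t y - s)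
    (hs : 2 * s ≤ dist t x + dist t y - dist x y) : dist u v ≤ 4 * δ := by
  have h1 := hX.four_point x v t y
  have hxv : dist x v ≤ dist t x - s + 2 * δ := by
    rw [hv', dist_comm x t, dist_comm v t, hv] at h1
    rcases max_cases (dist t x + (dist t y - s)) (dist x y + s) with ⟨h, _⟩ | ⟨h, _⟩ <;>
      rw [h] at h1 <;> linarith
  have h2 := hX.four_point u v t x
  rw [dist_comm u t, hu, dist_comm v x, dist_comm v t, hv, hu'] at h2
  rcases max_cases (s + dist x v) (dist t x - s + s) with ⟨h, _⟩ | ⟨h, _⟩ <;>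
    rw [h] at h2 <;> linarith

/-- `p` is a point of `Y` almost nearest to `c`. -/
def IsNearest (δ : ℝ) (Y : Set X) (c p : X) : Prop :=
  p ∈ Y ∧ ∀ y ∈ Y, dist c p ≤ dist c y + δ

theorem exists_isNearest (hδ : 0 < δ) {Y : Set X} (hY : Y.Nonempty) (c : X) :
    ∃ p, IsNearest δ Y c p := by
  obtain ⟨p, hp, h⟩ := (Metric.infDist_lt_iff hY).1
    (show Metric.infDist c Y < Metric.infDist c Y + δ by linarith)
  exact ⟨p, hp, fun y hy => by linarith [Metric.infDist_le_dist_of_mem (x := c) hy]⟩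

/-- Let `g` be the Gromov product of `c` and `y` at `p`. The point of `[p, y]` at distance `g` from
`p` is nearer to `c` than `p` by `g - 2δ` and within `11δ` of `Y`. Almost minimality of `p` then
forces `g ≤ 14δ`. -/
theorem IsNearest.dist_add_le (hδ : 0 < δ) (hX : IsGeodesicSpace X)
    (hX' : IsGromovHyperbolic X δ) {Y : Set X} (hY : IsQuasiConvex (10 * δ) Y) {c p y : X}
    (hp : IsNearest δ Y c p) (hy : y ∈ Y) : dist c p + dist p y ≤ dist c y + 28 * δ := by
  set g := (dist c p + dist p y - dist c y) / 2 with hg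
  have hg0 : 0 ≤ g := by linarith [dist_triangle c p y]
  have hgy : g ≤ dist p y := by linarith [dist_triangle c y p, dist_comm p y]
  obtain ⟨m, hm, h1, h2⟩ := hY.exists_point hX hp.1 hy ⟨hg0, hgy⟩
  obtain ⟨y', hy', hmy⟩ := exists_dist_lt_of_mem_cthickening hm (by linarith)
    (show 10 * δ < 11 * δ by linarith)
  have h4 := hX'.four_point c m p y
  rw [h2, dist_comm m p, h1] at h4
  have h5 := hp.2 y' hy'
  have h6 := dist_triangle c m y'
  rcases max_cases (dist c p + (dist p y - g)) (dist c y + g) with ⟨h, _⟩ | ⟨h, _⟩ <;>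
    rw [h] at h4 <;> linarith

/-- Adding the broken-path estimates for `(c, p')` and `(c', p)` and applying the four-point
inequality leaves these two possibilities, one for each term of the maximum. -/
theorem IsNearest.dist_split (hδ : 0 < δ) (hX : IsGeodesicSpace X)
    (hX' : IsGromovHyperbolic X δ) {Y : Set X} (hY : IsQuasiConvex (10 * δ) Y) {c p c' p' : X}
    (hp : IsNearest δ Y c p) (hp' : IsNearest δ Y c' p') :
    dist p p' ≤ 29 * δ ∨ dist c p + dist p p' + dist p' c' ≤ dist c c' + 58 * δ := by
  have h1 := hp.dist_add_le hδ hX hX' hY hp'.1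
  have h2 := hp'.dist_add_le hδ hX hX' hY hp.1
  have h3 := hX'.four_point c p' c' p
  rw [dist_comm p' p] at h2
  rcases max_cases (dist c c' + dist p' p) (dist c p + dist p' c') with ⟨h, _⟩ | ⟨h, _⟩ <;>
    rw [h] at h3
  · right
    linarith [dist_comm p' p, dist_comm c' p']
  · left
    linarith [dist_comm c' p']

/-- If `p` and `p'` are far apart, the geodesic `[p, p']` without its ends follows `[c, c']`. It
then lies in the `20δ`-neighbourhoods of both subsets on a length greater than `Δ`. -/
theorem IsNearest.dist_le_of_largestPiece (hδ : 0 < δ) {Δ : ℝ} (hΔ : 0 ≤ Δ)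
    (hX : IsGeodesicSpace X) (hX' : IsGromovHyperbolic X δ) {Y : I → Set X}
    (hY : ∀ i, IsQuasiConvex (10 * δ) (Y i)) (hpiece : largestPiece δ Y ≤ ENNReal.ofReal Δ)
    {i j : I} (hij : i ≠ j) {c c' p p' : X} (hc : c ∈ Y j) (hc' : c' ∈ Y j)
    (hp : IsNearest δ (Y i) c p) (hp' : IsNearest δ (Y i) c' p') :
    dist p p' ≤ Δ + 60 * δ := by
  by_contra! hlt
  have hdiam : ∀ a ∈ Metric.cthickening (20 * δ) (Y i) ∩ Metric.cthickening (20 * δ) (Y j),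
      ∀ b ∈ Metric.cthickening (20 * δ) (Y i) ∩ Metric.cthickening (20 * δ) (Y j),
      dist a b ≤ Δ := by
    intro a ha b hb
    have h1 : edist a b ≤ ENNReal.ofReal Δ :=
      (Metric.edist_le_ediam_of_mem ha hb).trans
        ((le_iSup₂_of_le i j (le_iSup (fun _ : i ≠ j => Metric.ediam
          (Metric.cthickening (20 * δ) (Y i) ∩ Metric.cthickening (20 * δ) (Y j))) hij)).trans
          hpiece)
    rw [edist_dist] at h1
    exact (ENNReal.ofReal_le_ofReal_iff hΔ).1 h1
  have hsplit := (hp.dist_split hδ hX hX' (hY i) hp').resolve_left (by linarith)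
  have hadd := hp.dist_add_le hδ hX hX' (hY i) hp'.1
  have htri := dist_triangle c p p'
  -- From `m` one passes to a point of `[p', c]`, then to a point of `[c, c']`, each at distance at
  -- most `4δ`, and finally to a point of `Y j` at distance less than `12δ`. The total is the `20δ`
  -- of the definition of pieces.
  have key : ∀ m, ∀ x, dist p m = x → dist m p' = dist p p' - x → 28 * δ ≤ x →
      x ≤ dist p p' - 29 * δ → m ∈ Metric.cthickening (20 * δ) (Y j) := by
    intro m x hm1 hm2 hx1 hx2
    have hcp := dist_nonneg (x := c) (y := p)
    obtain ⟨n₁, hn1, hn1'⟩ := hX.exists_point p' c (τ := dist p p' - x)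
      ⟨by linarith, by rw [dist_comm p' c]; linarith⟩
    have d1 : dist m n₁ ≤ 4 * δ := by
      refine hX'.dist_le_of_tripod hδ.le (t := p') (x := p) (y := c) (s := dist p p' - x)
        (by rw [dist_comm, hm2]) ?_ hn1 hn1' ?_
      · rw [dist_comm m p, hm1, dist_comm p' p]; ring
      · rw [dist_comm p' p, dist_comm p' c, dist_comm p c]; linarith
    set s := dist c p' - (dist p p' - x) with hs
    have hs0 : 0 ≤ s := by linarith
    have hs2 : 2 * s ≤ dist c p' + dist c c' - dist p' c' := by linarith
    have hsc : s ≤ dist c c' := by linarith [dist_triangle c c' p', dist_comm c' p']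
    obtain ⟨n₂, hn2m, hn2, hn2'⟩ := (hY j).exists_point hX hc hc' ⟨hs0, hsc⟩
    have d2 : dist n₁ n₂ ≤ 4 * δ :=
      hX'.dist_le_of_tripod hδ.le (t := c) (x := p') (y := c') (s := s)
        (by rw [dist_comm, hn1', dist_comm p' c]) (by rw [dist_comm, hn1]; ring) hn2 hn2' hs2
    obtain ⟨y, hy, hny⟩ := exists_dist_lt_of_mem_cthickening hn2m (by linarith)
      (show 10 * δ < 12 * δ by linarith)
    refine Metric.mem_cthickening_of_dist_le m y _ _ hy ?_
    linarith [dist_triangle m n₁ y, dist_triangle n₁ n₂ y]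
  obtain ⟨γ, h0, h1, h⟩ := hX p p'
  have hin : ∀ x ∈ Set.Icc (28 * δ) (dist p p' - 29 * δ),
      γ x ∈ Metric.cthickening (20 * δ) (Y i) ∩ Metric.cthickening (20 * δ) (Y j) := by
    intro x hx
    have hx' : x ∈ Set.Icc 0 (dist p p') := ⟨by linarith [hx.1], by linarith [hx.2]⟩
    refine ⟨Metric.cthickening_mono (by linarith) _ (hY i p hp.1 p' hp'.1 γ ⟨h0, h1, h⟩ x hx'),
      key _ x ?_ ?_ hx.1 hx.2⟩
    · have := h 0 ⟨le_rfl, dist_nonneg⟩ x hx'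
      rw [h0, zero_sub, abs_neg, abs_of_nonneg hx'.1] at this
      exact this
    · have := h x hx' (dist p p') ⟨dist_nonneg, le_rfl⟩
      rw [h1, abs_sub_comm, abs_of_nonneg (by linarith [hx'.2])] at this
      exact this
  have hfin := hdiam _ (hin (28 * δ) ⟨le_rfl, by linarith⟩) _
    (hin (dist p p' - 29 * δ) ⟨by linarith, le_rfl⟩)
  rw [h _ ⟨by linarith, by linarith⟩ _ ⟨by linarith, by linarith⟩, abs_sub_comm,
    abs_of_nonneg (by linarith)] at hfin
  linarith

/-- Coarse nearest point projections to the members of a family of subsets with bounded overlaps: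
a geodesic whose projection is long passes near its endpoints. -/
structure CoarseProjections (Y : I → Set X) (K : ℝ) where
  proj : I → X → X
  mem : ∀ i, (Y i).Nonempty → ∀ x, proj i x ∈ Y i
  fix : ∀ i, ∀ x ∈ Y i, proj i x = x
  split : ∀ i, (Y i).Nonempty → ∀ x x', dist (proj i x) (proj i x') ≤ K ∨
    dist x (proj i x) + dist (proj i x) (proj i x') + dist (proj i x') x' ≤ dist x x' + K
  small : ∀ i j, i ≠ j → (Y i).Nonempty → ∀ x ∈ Y j, ∀ x' ∈ Y j,
    dist (proj i x) (proj i x') ≤ K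

theorem exists_coarseProjections (hδ : 0 < δ) {Δ : ℝ} (hΔ : 0 ≤ Δ)
    (hX : IsGeodesicSpace X) (hX' : IsGromovHyperbolic X δ) {Y : I → Set X}
    (hY : ∀ i, IsQuasiConvex (10 * δ) (Y i)) (hpiece : largestPiece δ Y ≤ ENNReal.ofReal Δ) :
    Nonempty (CoarseProjections Y (Δ + 60 * δ)) := by
  have h : ∀ i x, ∃ p, (x ∈ Y i → p = x) ∧ ((Y i).Nonempty → IsNearest δ (Y i) x p) := by
    intro i x
    by_cases hx : x ∈ Y i
    · exact ⟨x, fun _ => rfl, fun _ => ⟨hx, fun y _ => by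
        rw [dist_self]; linarith [dist_nonneg (x := x) (y := y)]⟩⟩
    · by_cases hne : (Y i).Nonempty
      · obtain ⟨p, hp⟩ := exists_isNearest hδ hne x
        exact ⟨p, fun h => absurd h hx, fun _ => hp⟩
      -- The projection to an empty subset is a default value, about which nothing is claimed.
      · exact ⟨x, fun _ => rfl, fun h => absurd h hne⟩
  choose π hπ hπ' using h
  refine ⟨⟨π, fun i hi x => (hπ' i x hi).1, fun i x hx => hπ i x hx, fun i hi x x' => ?_,
    fun i j hij hi x hx x' hx' => ?_⟩⟩
  · rcases (hπ' i x hi).dist_split hδ hX hX' (hY i) (hπ' i x' hi) with h | h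
    · left; linarith
    · right; linarith
  · exact IsNearest.dist_le_of_largestPiece hδ hΔ hX hX' hY hpiece hij hx hx' (hπ' i x hi)
      (hπ' i x' hi)

end

/-! ### Points of the cone-off -/

namespace ConeOff

section

variable {X I : Type*} {r₀ : ℝ} {Y : I → Set X}

/-- The image of a point of `X`. -/
def point (r₀ : ℝ) (Y : I → Set X) (x : X) : ConeOff r₀ Y := proj (.inl x)

/-- The image of a point of a cone. -/
def cone (i : I) (u : Cone r₀ (Y i)) : ConeOff r₀ Y := proj (.inr ⟨i, u⟩)

theorem cone_top (hr₀ : 0 < r₀) (i : I) (y : Y i) :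
    (cone i (Cone.top hr₀ y) : ConeOff r₀ Y) = point r₀ Y y :=
  (Quot.sound ⟨i, y, ⟨r₀, hr₀.le, le_rfl⟩, rfl, rfl, rfl⟩ :
    (proj (.inl (y : X)) : ConeOff r₀ Y) = proj (.inr ⟨i, Cone.top hr₀ y⟩)).symm

/-- The base point in `X` of a point of the cone-off. -/
def base (hr₀ : 0 < r₀) : ConeOff r₀ Y → X :=
  Quot.lift (fun a : ConeOffSum r₀ Y => Sum.elim id (fun c => (c.2.base : X)) a) (by
    rintro a b ⟨i, y, r, hr, rfl, rfl⟩
    change (y : X) = ((Cone.mk y r).base : X)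
    rw [Cone.base_mk _ _ (by rw [hr]; exact hr₀.ne')])

open Classical in
/-- The point of the cone defining a point of the cone-off that is not in `X`. -/
def inner : ConeOff r₀ Y → Option (Σ i : I, Cone r₀ (Y i)) :=
  Quot.lift (fun a : ConeOffSum r₀ Y =>
    Sum.elim (fun _ => none) (fun c => if c.2.height = r₀ then none else some c) a) (by
    rintro a b ⟨i, y, r, hr, rfl, rfl⟩
    simp [hr])

@[simp] theorem base_point (hr₀ : 0 < r₀) (x : X) : (point r₀ Y x).base hr₀ = x := rfl

@[simp] theorem base_cone (hr₀ : 0 < r₀) (i : I) (u : Cone r₀ (Y i)) :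
    (cone i u : ConeOff r₀ Y).base hr₀ = u.base := rfl

@[simp] theorem inner_point (x : X) : (point r₀ Y x).inner = none := rfl

theorem inner_cone_of_eq (i : I) (u : Cone r₀ (Y i)) (h : u.height = r₀) :
    (cone i u : ConeOff r₀ Y).inner = none := if_pos h

theorem inner_cone_of_ne (i : I) (u : Cone r₀ (Y i)) (h : u.height ≠ r₀) :
    (cone i u : ConeOff r₀ Y).inner = some ⟨i, u⟩ := if_neg h

theorem cone_eq_point (hr₀ : 0 < r₀) (i : I) (u : Cone r₀ (Y i)) (h : u.height = r₀) :
    (cone i u : ConeOff r₀ Y) = point r₀ Y u.base := by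
  rw [← cone_top hr₀, ← Cone.eq_top hr₀ u h]

theorem eq_point_of_inner (hr₀ : 0 < r₀) (z : ConeOff r₀ Y) (h : z.inner = none) :
    z = point r₀ Y (z.base hr₀) := by
  induction z using Quot.inductionOn with
  | _ a =>
  rcases a with x | ⟨i, u⟩
  · rfl
  · change (cone i u).inner = none at h
    by_cases hu : u.height = r₀
    · exact cone_eq_point hr₀ i u hu
    · rw [inner_cone_of_ne i u hu] at h
      exact absurd h (by simp)

theorem eq_cone_of_inner {z : ConeOff r₀ Y} {i : I} {u : Cone r₀ (Y i)}
    (h : z.inner = some ⟨i, u⟩) : z = cone i u ∧ u.height ≠ r₀ := by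
  induction z using Quot.inductionOn with
  | _ a =>
  rcases a with x | ⟨j, v⟩
  · change (point r₀ Y x).inner = _ at h
    rw [inner_point] at h
    exact absurd h (by simp)
  · change (cone j v).inner = _ at h
    by_cases hv : v.height = r₀
    · rw [inner_cone_of_eq j v hv] at h
      exact absurd h (by simp)
    · rw [inner_cone_of_ne j v hv, Option.some_inj] at h
      cases h
      exact ⟨rfl, hv⟩

theorem height_eq_of_point_eq_cone {x : X} {i : I} {u : Cone r₀ (Y i)}
    (h : point r₀ Y x = cone i u) : u.height = r₀ := by
  by_contra hne
  have := congrArg inner h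
  rw [inner_point, inner_cone_of_ne i u hne] at this
  exact absurd this (by simp)

theorem base_eq_of_point_eq_cone (hr₀ : 0 < r₀) {x : X} {i : I} {u : Cone r₀ (Y i)}
    (h : point r₀ Y x = cone i u) : (u.base : X) = x :=
  (congrArg (base hr₀) h).symm

theorem eq_point_or_eq_cone (z : ConeOff r₀ Y) :
    (∃ x, z = point r₀ Y x) ∨ ∃ i u, z = cone i u := by
  induction z using Quot.inductionOn with
  | _ a =>
  rcases a with x | ⟨i, u⟩
  · exact Or.inl ⟨x, rfl⟩
  · exact Or.inr ⟨i, u, rfl⟩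

/-- `z` is not an interior point of the `i`-th cone. -/
def Outer (i : I) (z : ConeOff r₀ Y) : Prop := ∀ u, z.inner ≠ some ⟨i, u⟩

theorem outer_point (i : I) (x : X) : Outer i (point r₀ Y x) := fun u => by simp

theorem outer_cone {i j : I} (hij : i ≠ j) (u : Cone r₀ (Y j)) :
    Outer i (cone j u : ConeOff r₀ Y) := by
  intro v hv
  obtain ⟨h, -⟩ := eq_cone_of_inner hv
  by_cases hu : u.height = r₀
  · rw [inner_cone_of_eq j u hu] at hv
    exact absurd hv (by simp)
  · rw [inner_cone_of_ne j u hu, Option.some_inj] at hv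
    exact hij (congrArg Sigma.fst hv).symm

theorem exists_eq_cone_of_not_outer (i : I) {z : ConeOff r₀ Y} (h : ¬ Outer i z) :
    ∃ u, z = cone i u := by
  unfold Outer at h
  push Not at h
  obtain ⟨u, hu⟩ := h
  exact ⟨u, (eq_cone_of_inner hu).1⟩

end

/-! ### Walks -/

section

variable {X I : Type*} [MetricSpace X] {r₀ : ℝ} {Y : I → Set X}

theorem edist_eq_chainDist (z w : ConeOff r₀ Y) : edist z w = chainDist z w := rfl

theorem dist_point_le (x x' : X) : dist (point r₀ Y x) (point r₀ Y x') ≤ dist x x' := by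
  rw [← edist_le_ofReal dist_nonneg, edist_eq_chainDist, ← edist_dist]
  exact (chainDist_le_link _ _).trans (link_proj_le _ _)

theorem dist_cone_le (i : I) (u u' : Cone r₀ (Y i)) :
    dist (cone i u : ConeOff r₀ Y) (cone i u') ≤ Cone.distance u u' := by
  rw [← edist_le_ofReal (Cone.distance_nonneg _ _), edist_eq_chainDist]
  exact (chainDist_le_link _ _).trans ((link_proj_le _ _).trans
    (ConeOffSum.distance_cone i u u').le)

/-- `Walk z w n L`: there is a chain of length `L` with `n` steps from `z` to `w`, each step being
between two points of `X` or two points of the same cone. -/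
inductive Walk : ConeOff r₀ Y → ConeOff r₀ Y → ℕ → ℝ → Prop
  | nil (z : ConeOff r₀ Y) : Walk z z 0 0
  | point (x x' : X) {w : ConeOff r₀ Y} {n : ℕ} {L : ℝ} (h : Walk (point r₀ Y x') w n L) :
      Walk (point r₀ Y x) w (n + 1) (dist x x' + L)
  | cone (i : I) (u u' : Cone r₀ (Y i)) {w : ConeOff r₀ Y} {n : ℕ} {L : ℝ}
      (h : Walk (cone i u') w n L) : Walk (cone i u) w (n + 1) (Cone.distance u u' + L)

theorem Walk.dist_le {z w : ConeOff r₀ Y} {n : ℕ} {L : ℝ} (h : Walk z w n L) : dist z w ≤ L := by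
  induction h with
  | nil z => simp
  | point x x' h ih =>
    exact (dist_triangle _ (ConeOff.point r₀ Y x') _).trans (add_le_add (dist_point_le _ _) ih)
  | cone i u u' h ih =>
    exact (dist_triangle _ (ConeOff.cone i u') _).trans (add_le_add (dist_cone_le _ _ _) ih)

theorem exists_step_of_link_lt {z w : ConeOff r₀ Y} {c : ℝ}
    (h : link z w < ENNReal.ofReal c) :
    (∃ x x', z = point r₀ Y x ∧ w = point r₀ Y x' ∧ dist x x' < c) ∨
      ∃ (i : I) (u u' : Cone r₀ (Y i)), z = cone i u ∧ w = cone i u' ∧ Cone.distance u u' < c := by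
  unfold link at h
  simp only [iInf_lt_iff] at h
  obtain ⟨a, a', rfl, rfl, h⟩ := h
  rcases a with x | ⟨i, u⟩ <;> rcases a' with x' | ⟨j, u'⟩
  · left
    refine ⟨x, x', rfl, rfl, ?_⟩
    have h' : edist x x' < ENNReal.ofReal c := h
    rwa [edist_lt_ofReal] at h'
  · exact absurd h (by simp [ConeOffSum.distance])
  · exact absurd h (by simp [ConeOffSum.distance])
  · right
    simp only [ConeOffSum.distance, iInf_lt_iff] at h
    obtain ⟨k, v, v', h1, h2, h⟩ := h
    refine ⟨k, v, v', ?_, ?_, ENNReal.ofReal_lt_ofReal_iff'.1 h |>.1⟩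
    · rw [h1]; rfl
    · rw [h2]; rfl

theorem exists_walk_of_sum_lt (n : ℕ) (f : ℕ → ConeOff r₀ Y) (c : ℝ)
    (h : ∑ j ∈ Finset.range n, link (f j) (f (j + 1)) < ENNReal.ofReal c) :
    ∃ m L, Walk (f 0) (f n) m L ∧ L < c := by
  induction n generalizing f c with
  | zero =>
    refine ⟨0, 0, Walk.nil _, ?_⟩
    simpa using h
  | succ n ih =>
    rw [Finset.sum_range_succ'] at h
    set a := ∑ j ∈ Finset.range n, link (f (j + 1)) (f (j + 1 + 1)) with ha
    set b := link (f 0) (f (0 + 1)) with hb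
    have htop : a + b ≠ ∞ := (h.trans ENNReal.ofReal_lt_top).ne
    obtain ⟨hat, hbt⟩ := ENNReal.add_ne_top.1 htop
    have hsum : a.toReal + b.toReal < c := by
      rw [← ENNReal.toReal_add hat hbt]
      exact (ENNReal.lt_ofReal_iff_toReal_lt htop).1 h
    set e := (c - a.toReal - b.toReal) / 2 with he
    have he0 : 0 < e := by linarith
    obtain ⟨m, L, hw, hL⟩ := ih (fun j => f (j + 1)) (a.toReal + e)
      ((ENNReal.lt_ofReal_iff_toReal_lt hat).2 (by linarith))
    have hstep := exists_step_of_link_lt (c := b.toReal + e)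
      (show link (f 0) (f (0 + 1)) < _ from
        (ENNReal.lt_ofReal_iff_toReal_lt hbt).2 (by linarith))
    simp only [zero_add] at hw hstep
    rcases hstep with ⟨x, x', h0, h1, hd⟩ | ⟨i, u, u', h0, h1, hd⟩
    · rw [h1] at hw
      rw [h0]
      exact ⟨m + 1, _, Walk.point x x' hw, by linarith⟩
    · rw [h1] at hw
      rw [h0]
      exact ⟨m + 1, _, Walk.cone i u u' hw, by linarith⟩

theorem exists_walk {z w : ConeOff r₀ Y} {c : ℝ} (h : dist z w < c) :
    ∃ n L, Walk z w n L ∧ L < c := by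
  have h1 : chainDist z w < ENNReal.ofReal c := by
    rw [← edist_eq_chainDist, edist_lt_ofReal]; exact h
  unfold chainDist at h1
  simp only [iInf_lt_iff] at h1
  obtain ⟨n, f, rfl, rfl, h1⟩ := h1
  exact exists_walk_of_sum_lt n f c h1

/-! ### Walks with a bounded number of steps -/

/-- Walks from a point of `X` to `w` which alternate between steps in `X` and chords of cones;
`m` counts the chords. -/
inductive NormalWalk (hr₀ : 0 < r₀) (w : ConeOff r₀ Y) : X → ℕ → ℝ → Prop
  | last_point (x b : X) (hw : w = point r₀ Y b) : NormalWalk hr₀ w x 0 (dist x b)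
  | last_cone (x : X) (i : I) (y : Y i) (u : Cone r₀ (Y i)) (hw : w = cone i u) :
      NormalWalk hr₀ w x 0 (dist x y + Cone.distance (Cone.top hr₀ y) u)
  | chord (x : X) (i : I) (y y' : Y i) {m : ℕ} {L : ℝ} (h : NormalWalk hr₀ w y' m L) :
      NormalWalk hr₀ w x (m + 1)
        (dist x y + (Cone.distance (Cone.top hr₀ y) (Cone.top hr₀ y') + L))

theorem NormalWalk.cons {hr₀ : 0 < r₀} {w : ConeOff r₀ Y} (x : X) {x' : X} {m : ℕ} {L : ℝ}
    (h : NormalWalk hr₀ w x' m L) : ∃ L', NormalWalk hr₀ w x m L' ∧ L' ≤ dist x x' + L := by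
  cases h with
  | last_point _ b hw => exact ⟨_, .last_point x b hw, dist_triangle _ _ _⟩
  | last_cone _ i y u hw =>
    exact ⟨_, .last_cone x i y u hw, by linarith [dist_triangle x x' y]⟩
  | chord _ i y y' h =>
    exact ⟨_, .chord x i y y' h, by linarith [dist_triangle x x' y]⟩

theorem NormalWalk.exists_walk {hr₀ : 0 < r₀} {w : ConeOff r₀ Y} {x : X} {m : ℕ} {L : ℝ}
    (h : NormalWalk hr₀ w x m L) : ∃ n ≤ 2 * m + 2, Walk (ConeOff.point r₀ Y x) w n L := by
  induction h with
  | last_point x b hw =>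
    subst hw
    exact ⟨1, by omega, by simpa using Walk.point x b (Walk.nil (ConeOff.point r₀ Y b))⟩
  | last_cone x i y u hw =>
    subst hw
    refine ⟨2, by omega, Walk.point x y ?_⟩
    rw [← cone_top hr₀]
    simpa using Walk.cone i (Cone.top hr₀ y) u (Walk.nil _)
  | chord x i y y' h ih =>
    obtain ⟨n, hn, hw⟩ := ih
    refine ⟨n + 2, by omega, Walk.point x y ?_⟩
    rw [← cone_top hr₀] at hw ⊢
    exact Walk.cone i _ _ hw

/-- Consecutive steps in `X`, or in one cone, are merged by the triangle inequality. A chord over a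
base distance at most `a` is replaced by a step in `X`, which the factor `1 + κ` pays for. Each
remaining chord has length at least `coneMetric r₀ r₀ r₀ a`, and the same factor leaves `κ` times
this length over, so the number of chords can be charged to the length. A walk starting in a cone
either ends in it after a single chord, or leaves it through a top point `y`. -/
theorem Walk.normalize (hr₀ : 0 < r₀) {κ a : ℝ} (hκ : 0 ≤ κ)
    (ha : ∀ ℓ, 0 ≤ ℓ → ℓ ≤ a → ℓ ≤ (1 + κ) * coneMetric r₀ r₀ r₀ ℓ) (ha0 : 0 ≤ a)
    {z w : ConeOff r₀ Y} {n : ℕ} {L : ℝ} (h : Walk z w n L) :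
    (∀ x, z = ConeOff.point r₀ Y x → ∃ m L', NormalWalk hr₀ w x m L' ∧
      L' + κ * coneMetric r₀ r₀ r₀ a * m ≤ (1 + κ) * L) ∧
    ∀ i u, z = ConeOff.cone i u →
      (∃ u', w = ConeOff.cone i u' ∧ Cone.distance u u' ≤ L) ∨
      ∃ (y : Y i) (m : ℕ) (L' : ℝ), NormalWalk hr₀ w y m L' ∧
        (1 + κ) * Cone.distance u (Cone.top hr₀ y) + (L' + κ * coneMetric r₀ r₀ r₀ a * m) ≤
          (1 + κ) * L := by
  -- A point that is both in `X` and in a cone leaves the cone at itself, at no cost.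
  have cone_of_point : ∀ {L : ℝ} {z : ConeOff r₀ Y} {i : I} {u : Cone r₀ (Y i)},
      z = ConeOff.cone i u → (∀ x, z = ConeOff.point r₀ Y x → ∃ m L', NormalWalk hr₀ w x m L' ∧
        L' + κ * coneMetric r₀ r₀ r₀ a * m ≤ (1 + κ) * L) → (∃ x, z = ConeOff.point r₀ Y x) →
      ∃ (y : Y i) (m : ℕ) (L' : ℝ), NormalWalk hr₀ w y m L' ∧
        (1 + κ) * Cone.distance u (Cone.top hr₀ y) + (L' + κ * coneMetric r₀ r₀ r₀ a * m) ≤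
          (1 + κ) * L := by
    rintro L z i u hzu hA ⟨x, hx⟩
    obtain ⟨m, L', hN, hL⟩ := hA x hx
    have hpc : ConeOff.point r₀ Y x = ConeOff.cone i u := by rw [← hx, hzu]
    have hb := base_eq_of_point_eq_cone hr₀ hpc
    have ht := Cone.eq_top hr₀ u (height_eq_of_point_eq_cone hpc)
    refine ⟨u.base, m, L', by rw [hb]; exact hN, ?_⟩
    rw [← ht, Cone.distance_self]
    linarith
  induction h with
  | nil z =>
    refine ⟨fun x hx => ⟨0, 0, ?_, by simp⟩, fun i u hu => Or.inl ⟨u, hu, ?_⟩⟩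
    · simpa using NormalWalk.last_point (hr₀ := hr₀) x x hx
    · rw [Cone.distance_self]
  | @point x x' w n L h ih =>
    have hA : ∀ b, ConeOff.point r₀ Y x = ConeOff.point r₀ Y b →
        ∃ m L', NormalWalk hr₀ w b m L' ∧
          L' + κ * coneMetric r₀ r₀ r₀ a * m ≤ (1 + κ) * (dist x x' + L) := by
      intro b hb
      have : x = b := congrArg (base hr₀) hb
      subst this
      obtain ⟨m, L', hN, hL⟩ := (ih cone_of_point).1 x' rfl
      obtain ⟨L'', hN', hL'⟩ := hN.cons x
      refine ⟨m, L'', hN', ?_⟩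
      nlinarith [mul_nonneg hκ (dist_nonneg (x := x) (y := x'))]
    exact ⟨hA, fun i u hu => Or.inr (cone_of_point hu hA ⟨x, rfl⟩)⟩
  | @cone i u u' w n L h ih =>
    have hB : (∃ u₁, w = ConeOff.cone i u₁ ∧ Cone.distance u u₁ ≤ Cone.distance u u' + L) ∨
        ∃ (y : Y i) (m : ℕ) (L' : ℝ), NormalWalk hr₀ w y m L' ∧
          (1 + κ) * Cone.distance u (Cone.top hr₀ y) + (L' + κ * coneMetric r₀ r₀ r₀ a * m) ≤
            (1 + κ) * (Cone.distance u u' + L) := by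
      rcases (ih cone_of_point).2 i u' rfl with ⟨u₁, hw, hd⟩ | ⟨y, m, L', hN, hL⟩
      · exact Or.inl ⟨u₁, hw, by linarith [Cone.distance_triangle hr₀ u u' u₁]⟩
      · refine Or.inr ⟨y, m, L', hN, ?_⟩
        nlinarith [Cone.distance_triangle hr₀ u u' (Cone.top hr₀ y)]
    have hA : ∀ b, ConeOff.cone i u = ConeOff.point r₀ Y b → ∃ m L', NormalWalk hr₀ w b m L' ∧
        L' + κ * coneMetric r₀ r₀ r₀ a * m ≤ (1 + κ) * (Cone.distance u u' + L) := by
      intro b hb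
      have hub := base_eq_of_point_eq_cone hr₀ hb.symm
      have ht := Cone.eq_top hr₀ u (height_eq_of_point_eq_cone hb.symm)
      rcases hB with ⟨u₁, hw, hd⟩ | ⟨y, m, L', hN, hL⟩
      · refine ⟨0, _, NormalWalk.last_cone b i u.base u₁ hw, ?_⟩
        rw [← ht, hub, dist_self]
        have := Cone.distance_nonneg u u₁
        push_cast
        nlinarith
      -- A short chord becomes a step in `X`; a long one is kept and counted.
      · rcases le_total (dist u.base y) a with hle | hle
        · obtain ⟨L'', hN', hL'⟩ := hN.cons b
          refine ⟨m, L'', hN', ?_⟩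
          have := ha _ dist_nonneg hle
          rw [ht, Cone.distance_top_top] at hL
          rw [← hub] at hL'
          have e : dist (u.base : X) y = dist u.base y := rfl
          rw [← ht] at hL
          linarith
        · refine ⟨m + 1, _, NormalWalk.chord b i u.base y hN, ?_⟩
          have hmono := coneMetric_mono hr₀ hr₀.le hr₀.le ha0 hle
          rw [← ht, hub, dist_self]
          have e : Cone.distance u (Cone.top hr₀ y) = coneMetric r₀ r₀ r₀ (dist u.base y) := by
            conv_lhs => rw [ht]
            exact Cone.distance_top_top hr₀ _ _
          rw [← e] at hmono
          push_cast
          nlinarith [mul_le_mul_of_nonneg_left hmono hκ]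
    refine ⟨hA, fun j v hv => ?_⟩
    by_cases htop : u.height = r₀
    · exact Or.inr (cone_of_point hv hA ⟨_, cone_eq_point hr₀ i u htop⟩)
    · have h1 := inner_cone_of_ne (Y := Y) i u htop
      rw [hv] at h1
      have hv' : v.height ≠ r₀ := by
        intro h2
        rw [inner_cone_of_eq j v h2] at h1
        exact absurd h1 (by simp)
      rw [inner_cone_of_ne j v hv', Option.some_inj] at h1
      cases h1
      exact hB

end

end ConeOff

/-- Bounded distances in the cone-off are realized, up to a small error, by walks with a bounded
number of steps. -/
theorem ConeOff.exists_walk_le {r₀ : ℝ} (hr₀ : 0 < r₀) {L₀ η : ℝ} (hL₀ : 0 ≤ L₀) (hη : 0 < η) :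
    ∃ N : ℕ, ∀ (X : Type*) [MetricSpace X] (I : Type*) (Y : I → Set X) (z w : ConeOff r₀ Y),
      dist z w < L₀ → ∃ n ≤ N, ∃ L ≤ dist z w + η, ConeOff.Walk z w n L := by
  -- Multiplying lengths up to the scale `L₀` by `1 + κ` must cost less than `η`.
  set κ := min 1 (η / (4 * (L₀ + 1))) with hκ
  have hκ0 : 0 < κ := lt_min one_pos (by positivity)
  have hκ1 : κ ≤ 1 := min_le_left _ _
  have hκη : κ * L₀ ≤ η / 4 := by
    have : κ ≤ η / (4 * (L₀ + 1)) := min_le_right _ _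
    rw [le_div_iff₀ (by positivity)] at this
    nlinarith
  obtain ⟨a, ha0, hμ, ha⟩ := exists_le_mul_coneMetric hr₀ hκ0
  set lam := κ * coneMetric r₀ r₀ r₀ a with hlam
  have hlam0 : 0 < lam := by positivity
  -- Each long chord is charged `lam` against a total of at most `2 (L₀ + η)`. With `m` chords there
  -- are at most `2 * m + 2` steps, and one more to leave the initial cone. The bound involves
  -- neither `X` nor `Y`, so the hyperbolicity constant can be chosen after it.
  refine ⟨2 * ⌈2 * (L₀ + η) / lam⌉₊ + 3, fun X _ I Y z w hzw => ?_⟩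
  obtain ⟨n, L, hW, hL⟩ := ConeOff.exists_walk (show dist z w < dist z w + η / 4 by linarith)
  have hd0 : 0 ≤ dist z w := dist_nonneg
  have hLn : (1 + κ) * L ≤ dist z w + η := by
    nlinarith [mul_le_mul_of_nonneg_left hzw.le hκ0.le]
  have hL2 : (1 + κ) * L ≤ 2 * (L₀ + η) := by linarith
  have hm : ∀ {m : ℕ} {L' : ℝ}, 0 ≤ L' → L' + lam * m ≤ (1 + κ) * L →
      m ≤ ⌈2 * (L₀ + η) / lam⌉₊ := by
    intro m L' hL' h
    have : (m : ℝ) ≤ 2 * (L₀ + η) / lam := by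
      rw [le_div_iff₀ hlam0]; linarith
    exact_mod_cast this.trans (Nat.le_ceil _)
  obtain ⟨hA, hB⟩ := hW.normalize hr₀ hκ0.le ha ha0.le
  rcases z.eq_point_or_eq_cone with ⟨x, hx⟩ | ⟨i, u, hu⟩
  · obtain ⟨m, L', hN, hL'⟩ := hA x hx
    obtain ⟨n', hn', hW'⟩ := hN.exists_walk
    rw [← hx] at hW'
    have h0 := dist_nonneg.trans hW'.dist_le
    have hm' := hm h0 hL'
    have : 0 ≤ lam * m := by positivity
    exact ⟨n', by omega, L', by linarith, hW'⟩
  · rcases hB i u hu with ⟨u', hw, hd⟩ | ⟨y, m, L', hN, hL'⟩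
    · refine ⟨1, by omega, Cone.distance u u', by nlinarith, ?_⟩
      rw [hu, hw]
      simpa using ConeOff.Walk.cone i u u' (ConeOff.Walk.nil _)
    · obtain ⟨n', hn', hW'⟩ := hN.exists_walk
      have h0 := dist_nonneg.trans hW'.dist_le
      have hd0 := Cone.distance_nonneg u (Cone.top hr₀ y)
      have hm' := hm h0 (by nlinarith)
      have : 0 ≤ lam * m := by positivity
      rw [← ConeOff.cone_top hr₀] at hW'
      refine ⟨n' + 1, by omega, Cone.distance u (Cone.top hr₀ y) + L', by nlinarith, ?_⟩
      rw [hu]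
      exact ConeOff.Walk.cone i u _ hW'

/-! ### Projections to the cones -/

namespace ConeOff

section

variable {X I : Type*} [MetricSpace X] {r₀ : ℝ} {Y : I → Set X} {K : ℝ}

theorem Walk.trans {a b c : ConeOff r₀ Y} {n m : ℕ} {L M : ℝ} (h : Walk a b n L)
    (h' : Walk b c m M) : Walk a c (n + m) (L + M) := by
  induction h with
  | nil z => simpa using h'
  | point x x' h ih =>
    have := Walk.point x x' (ih h')
    rwa [← add_assoc, add_right_comm _ m 1] at this
  | cone i u u' h ih =>
    have := Walk.cone i u u' (ih h')
    rwa [← add_assoc, add_right_comm _ m 1] at this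

theorem Walk.symm {a b : ConeOff r₀ Y} {n : ℕ} {L : ℝ} (h : Walk a b n L) : Walk b a n L := by
  induction h with
  | nil z => exact Walk.nil z
  | point x x' h ih =>
    have := ih.trans (Walk.point x' x (Walk.nil _))
    rwa [zero_add, add_zero, add_comm _ (dist x' x), dist_comm] at this
  | cone i u u' h ih =>
    have := ih.trans (Walk.cone i u' u (Walk.nil _))
    rwa [zero_add, add_zero, add_comm _ (Cone.distance u' u), Cone.distance_comm] at this

open Classical in
/-- The projection of the cone-off to the `i`-th cone. -/
def retract (hr₀ : 0 < r₀) (π : CoarseProjections Y K) (i : I) (hi : (Y i).Nonempty)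
    (z : ConeOff r₀ Y) : Cone r₀ (Y i) :=
  if h : ∃ u, z.inner = some ⟨i, u⟩ then h.choose
  else Cone.top hr₀ ⟨π.proj i (z.base hr₀), π.mem i hi _⟩

/-- The image in the cone-off of the projection to the `i`-th cone. -/
def foot (hr₀ : 0 < r₀) (π : CoarseProjections Y K) (i : I) (hi : (Y i).Nonempty)
    (z : ConeOff r₀ Y) : ConeOff r₀ Y := cone i (retract hr₀ π i hi z)

variable (hr₀ : 0 < r₀) (π : CoarseProjections Y K) (i : I) (hi : (Y i).Nonempty)

theorem retract_of_outer {z : ConeOff r₀ Y} (h : Outer i z) :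
    retract hr₀ π i hi z = Cone.top hr₀ ⟨π.proj i (z.base hr₀), π.mem i hi _⟩ :=
  dif_neg (by push Not; exact h)

theorem retract_cone (u : Cone r₀ (Y i)) : retract hr₀ π i hi (cone i u) = u := by
  by_cases hu : u.height = r₀
  · rw [retract_of_outer]
    · conv_rhs => rw [Cone.eq_top hr₀ u hu]
      congr 1
      exact Subtype.ext (π.fix i _ u.base.2)
    · intro v
      rw [inner_cone_of_eq i u hu]
      simp
  · have h : ∃ v, (cone i u : ConeOff r₀ Y).inner = some ⟨i, v⟩ := ⟨u, inner_cone_of_ne i u hu⟩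
    have hs := (inner_cone_of_ne i u hu).symm.trans h.choose_spec
    rw [Option.some_inj] at hs
    rw [retract, dif_pos h]
    exact (eq_of_heq (Sigma.mk.inj_iff.1 hs).2).symm

theorem foot_cone (u : Cone r₀ (Y i)) : foot hr₀ π i hi (cone i u) = cone i u := by
  rw [foot, retract_cone]

theorem foot_of_not_outer {z : ConeOff r₀ Y} (h : ¬ Outer i z) : foot hr₀ π i hi z = z := by
  obtain ⟨u, rfl⟩ := exists_eq_cone_of_not_outer i h
  exact foot_cone hr₀ π i hi u

theorem foot_of_outer {z : ConeOff r₀ Y} (h : Outer i z) :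
    foot hr₀ π i hi z = point r₀ Y (π.proj i (z.base hr₀)) := by
  rw [foot, retract_of_outer hr₀ π i hi h, cone_top]

theorem base_retract (z : ConeOff r₀ Y) :
    ((retract hr₀ π i hi z).base : X) = π.proj i (z.base hr₀) := by
  by_cases h : Outer i z
  · rw [retract_of_outer hr₀ π i hi h, Cone.base_top]
  · obtain ⟨u, rfl⟩ := exists_eq_cone_of_not_outer i h
    rw [retract_cone, base_cone, π.fix i _ u.base.2]

theorem retract_foot (z : ConeOff r₀ Y) :
    retract hr₀ π i hi (foot hr₀ π i hi z) = retract hr₀ π i hi z := by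
  rw [foot, retract_cone]

theorem dist_foot_le {z z' : ConeOff r₀ Y} (h : Outer i z) (h' : Outer i z') :
    dist (foot hr₀ π i hi z) (foot hr₀ π i hi z') ≤
      dist (π.proj i (z.base hr₀)) (π.proj i (z'.base hr₀)) := by
  rw [foot_of_outer hr₀ π i hi h, foot_of_outer hr₀ π i hi h']
  exact dist_point_le _ _

theorem distance_retract_le {z z' : ConeOff r₀ Y} (h : Outer i z) (h' : Outer i z') :
    Cone.distance (retract hr₀ π i hi z) (retract hr₀ π i hi z') ≤
      dist (π.proj i (z.base hr₀)) (π.proj i (z'.base hr₀)) := by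
  rw [retract_of_outer hr₀ π i hi h, retract_of_outer hr₀ π i hi h']
  exact Cone.distance_top_top_le hr₀ _ _

theorem dist_foot_le_distance (z z' : ConeOff r₀ Y) :
    dist (foot hr₀ π i hi z) (foot hr₀ π i hi z') ≤
      Cone.distance (retract hr₀ π i hi z) (retract hr₀ π i hi z') := dist_cone_le _ _ _

/-- The projection to a cone is coarsely `1`-Lipschitz. -/
theorem Walk.distance_retract_le (hK : 0 ≤ K) {z z' : ConeOff r₀ Y} {n : ℕ} {L : ℝ}
    (h : Walk z z' n L) :
    Cone.distance (retract hr₀ π i hi z) (retract hr₀ π i hi z') ≤ L + n * K := by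
  induction h with
  | nil z => simp [Cone.distance_self]
  | @point x x' w n L h ih =>
    have h1 := ConeOff.distance_retract_le hr₀ π i hi (outer_point i x) (outer_point (r₀ := r₀) i x')
    rw [base_point, base_point] at h1
    have h2 : dist (π.proj i x) (π.proj i x') ≤ dist x x' + K := by
      rcases π.split i hi x x' with h | h
      · linarith [dist_nonneg (x := x) (y := x')]
      · linarith [dist_nonneg (x := x) (y := π.proj i x),
          dist_nonneg (x := π.proj i x') (y := x')]
    have h3 := Cone.distance_triangle hr₀ (retract hr₀ π i hi (ConeOff.point r₀ Y x))
      (retract hr₀ π i hi (ConeOff.point r₀ Y x')) (retract hr₀ π i hi w)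
    push_cast
    linarith
  | @cone j u u' w n L h ih =>
    have h3 := Cone.distance_triangle hr₀ (retract hr₀ π i hi (ConeOff.cone j u))
      (retract hr₀ π i hi (ConeOff.cone j u')) (retract hr₀ π i hi w)
    push_cast
    by_cases hij : i = j
    · subst hij
      rw [retract_cone, retract_cone] at h3
      rw [retract_cone] at ih ⊢
      linarith
    -- However long, a chord of another cone moves the projection by at most `K`, because its ends
    -- lie over `Y j`.
    · have h1 := ConeOff.distance_retract_le hr₀ π i hi (outer_cone hij u) (outer_cone hij u')
      have h2 := π.small i j hij hi _ u.base.2 _ u'.base.2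
      rw [base_cone, base_cone] at h1
      linarith [Cone.distance_nonneg u u']

/-- A walk to a point of a cone passes near the projection of its origin. -/
theorem Walk.dist_foot_add_le (hK : 0 ≤ K) {z z' : ConeOff r₀ Y} {n : ℕ} {L : ℝ}
    (h : Walk z z' n L) (u₁ : Cone r₀ (Y i)) (hz' : z' = ConeOff.cone i u₁) :
    dist z (foot hr₀ π i hi z) + dist (foot hr₀ π i hi z) z' ≤ L + 2 * n * K := by
  induction h with
  | nil z => subst hz'; simp [foot_cone]
  | @point x x' w n L h ih =>
    have ih := ih hz'
    have hd := h.dist_le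
    have f1 := foot_of_outer hr₀ π i hi (outer_point (r₀ := r₀) i x)
    have f2 := foot_of_outer hr₀ π i hi (outer_point (r₀ := r₀) i x')
    rw [base_point] at f1 f2
    rw [f2] at ih
    rw [f1]
    have d1 := dist_point_le (r₀ := r₀) (Y := Y) x x'
    have d2 := dist_point_le (r₀ := r₀) (Y := Y) (π.proj i x) (π.proj i x')
    have d3 := dist_point_le (r₀ := r₀) (Y := Y) x (π.proj i x)
    have d4 := dist_point_le (r₀ := r₀) (Y := Y) (π.proj i x') x'
    set p := ConeOff.point r₀ Y (π.proj i x)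
    set p' := ConeOff.point r₀ Y (π.proj i x')
    set a := ConeOff.point r₀ Y x
    set a' := ConeOff.point r₀ Y x'
    push_cast
    have hnK : 0 ≤ n * K := by positivity
    rcases π.split i hi x x' with h | h
    · linarith [dist_triangle a a' p, dist_triangle a' p' p, dist_triangle p p' w, dist_comm p p']
    · linarith [dist_triangle p a' w, dist_triangle p p' a']
  | @cone j u u' w n L h ih =>
    have ih := ih hz'
    have hd := h.dist_le
    have d1 := dist_cone_le j u u' (Y := Y)
    push_cast
    have hnK : 0 ≤ n * K := by positivity
    by_cases hij : i = j
    · subst hij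
      rw [foot_cone, dist_self]
      linarith [dist_triangle (ConeOff.cone i u) (ConeOff.cone i u') w]
    · have h1 := dist_foot_le hr₀ π i hi (outer_cone hij u) (outer_cone hij u')
      have h2 := π.small i j hij hi _ u.base.2 _ u'.base.2
      rw [base_cone, base_cone] at h1
      set a := (ConeOff.cone j u : ConeOff r₀ Y)
      set a' := (ConeOff.cone j u' : ConeOff r₀ Y)
      set p := foot hr₀ π i hi a
      set p' := foot hr₀ π i hi a'
      linarith [dist_triangle a a' p, dist_triangle a' p' p, dist_triangle p p' w, dist_comm p p']

/-- A walk between two points with distant projections to a cone passes near both projections. -/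
theorem Walk.dist_foot_foot_le (hK : 0 ≤ K) {z z' : ConeOff r₀ Y} {n : ℕ} {L : ℝ}
    (h : Walk z z' n L) :
    (Outer i z ∧ Outer i z' ∧
      dist (π.proj i (z.base hr₀)) (π.proj i (z'.base hr₀)) ≤ n * K) ∨
    dist z (foot hr₀ π i hi z) + dist (foot hr₀ π i hi z) (foot hr₀ π i hi z') +
      dist (foot hr₀ π i hi z') z' ≤ L + 4 * n * K := by
  induction h with
  | nil z =>
    by_cases h : Outer i z
    · left; exact ⟨h, h, by simp⟩
    · right; simp [foot_of_not_outer hr₀ π i hi h]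
  | @point x x' w n L h ih =>
    have hd := h.dist_le
    have f1 := foot_of_outer hr₀ π i hi (outer_point (r₀ := r₀) i x)
    have f2 := foot_of_outer hr₀ π i hi (outer_point (r₀ := r₀) i x')
    rw [base_point] at f1 f2
    rw [f2, base_point] at ih
    rw [f1, base_point]
    have d1 := dist_point_le (r₀ := r₀) (Y := Y) x x'
    have d2 := dist_point_le (r₀ := r₀) (Y := Y) (π.proj i x) (π.proj i x')
    have d3 := dist_point_le (r₀ := r₀) (Y := Y) x (π.proj i x)
    have d4 := dist_point_le (r₀ := r₀) (Y := Y) (π.proj i x') x'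
    set p := ConeOff.point r₀ Y (π.proj i x)
    set p' := ConeOff.point r₀ Y (π.proj i x')
    set a := ConeOff.point r₀ Y x
    set a' := ConeOff.point r₀ Y x'
    push_cast
    have hnK : 0 ≤ n * K := by positivity
    rcases ih with ⟨-, o2, ih⟩ | ih
    · rcases π.split i hi x x' with h | h
      · left
        exact ⟨outer_point i x, o2, by
          linarith [dist_triangle (π.proj i x) (π.proj i x') (π.proj i (w.base hr₀))]⟩
      · right
        have f3 := foot_of_outer hr₀ π i hi o2
        have d5 := dist_point_le (r₀ := r₀) (Y := Y) (π.proj i x') (π.proj i (w.base hr₀))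
        rw [← f3] at d5
        set q := foot hr₀ π i hi w
        linarith [dist_triangle p p' q, dist_triangle q p' w, dist_triangle p' a' w,
          dist_comm p' q]
    · right
      set q := foot hr₀ π i hi w
      rcases π.split i hi x x' with h | h
      · linarith [dist_triangle a a' p, dist_triangle a' p' p, dist_triangle p p' q, dist_comm p p']
      · linarith [dist_triangle p p' q, dist_comm a' p', dist_nonneg (x := a') (y := p')]
  | @cone j u u' w n L h ih =>
    have d1 := dist_cone_le j u u' (Y := Y)
    push_cast
    have hnK : 0 ≤ n * K := by positivity
    by_cases hij : i = j
    · subst hij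
      right
      -- Once the walk is in the cone, the reverse of its remainder ends there, so the one-sided
      -- estimate applies to it.
      have h1 := h.symm.dist_foot_add_le hr₀ π i hi hK u' rfl
      rw [foot_cone, dist_self]
      set a := (ConeOff.cone i u : ConeOff r₀ Y)
      set a' := (ConeOff.cone i u' : ConeOff r₀ Y)
      set q := foot hr₀ π i hi w
      linarith [dist_triangle a a' q, dist_comm a' q, dist_comm w q]
    · have h1 := dist_foot_le hr₀ π i hi (outer_cone hij u) (outer_cone hij u')
      have h2 := π.small i j hij hi _ u.base.2 _ u'.base.2
      rw [base_cone, base_cone] at h1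
      rcases ih with ⟨-, o2, ih⟩ | ih
      · left
        rw [base_cone] at ih ⊢
        exact ⟨outer_cone hij u, o2, by
          linarith [dist_triangle (π.proj i u.base) (π.proj i u'.base) (π.proj i (w.base hr₀))]⟩
      · right
        set a := (ConeOff.cone j u : ConeOff r₀ Y)
        set a' := (ConeOff.cone j u' : ConeOff r₀ Y)
        set p := foot hr₀ π i hi a
        set p' := foot hr₀ π i hi a'
        set q := foot hr₀ π i hi w
        linarith [dist_triangle a a' p, dist_triangle a' p' p, dist_triangle p p' q,
          dist_comm p p']

end

end ConeOff

/-! ### Uniform estimates for the projections at bounded scale -/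

namespace ConeOff

section

variable {X I : Type*} [MetricSpace X] {r₀ : ℝ} {Y : I → Set X} {K : ℝ}

/-- Distances at scale at most `L₀` are compatible with the projections to the cones, up to an
error `E`. -/
structure HasCoarseGates (hr₀ : 0 < r₀) (π : CoarseProjections Y K) (L₀ E : ℝ) : Prop where
  retract_le : ∀ (i : I) (hi : (Y i).Nonempty) (z z' : ConeOff r₀ Y), dist z z' < L₀ →
    Cone.distance (retract hr₀ π i hi z) (retract hr₀ π i hi z') ≤ dist z z' + E
  foot_le : ∀ (i : I) (hi : (Y i).Nonempty) (z : ConeOff r₀ Y) (u : Cone r₀ (Y i)),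
    dist z (cone i u) < L₀ →
    dist z (foot hr₀ π i hi z) + dist (foot hr₀ π i hi z) (cone i u) ≤ dist z (cone i u) + E
  foot_foot_le : ∀ (i : I) (hi : (Y i).Nonempty) (z z' : ConeOff r₀ Y), dist z z' < L₀ →
    (Outer i z ∧ Outer i z' ∧
      dist (π.proj i (z.base hr₀)) (π.proj i (z'.base hr₀)) ≤ E) ∨
    dist z (foot hr₀ π i hi z) + dist (foot hr₀ π i hi z) (foot hr₀ π i hi z') +
      dist (foot hr₀ π i hi z') z' ≤ dist z z' + E

theorem hasCoarseGates (hr₀ : 0 < r₀) (π : CoarseProjections Y K) (hK : 0 ≤ K) {L₀ η E : ℝ}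
    {N : ℕ} (hE : 4 * N * K + η ≤ E) (hη : 0 ≤ η)
    (hW : ∀ z w : ConeOff r₀ Y, dist z w < L₀ → ∃ n ≤ N, ∃ L ≤ dist z w + η, Walk z w n L) :
    HasCoarseGates hr₀ π L₀ E := by
  have hn : ∀ {n : ℕ}, n ≤ N → (n : ℝ) * K ≤ N * K := fun h =>
    mul_le_mul_of_nonneg_right (by exact_mod_cast h) hK
  have hNK : 0 ≤ N * K := by positivity
  refine ⟨fun i hi z z' h => ?_, fun i hi z u h => ?_, fun i hi z z' h => ?_⟩
  · obtain ⟨n, hnN, L, hL, hw⟩ := hW _ _ h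
    linarith [hw.distance_retract_le hr₀ π i hi hK, hn hnN]
  · obtain ⟨n, hnN, L, hL, hw⟩ := hW _ _ h
    linarith [hw.dist_foot_add_le hr₀ π i hi hK u rfl, hn hnN]
  · obtain ⟨n, hnN, L, hL, hw⟩ := hW _ _ h
    rcases hw.dist_foot_foot_le hr₀ π i hi hK with ⟨h1, h2, h3⟩ | h1
    · exact Or.inl ⟨h1, h2, by linarith [hn hnN]⟩
    · exact Or.inr (by linarith [hn hnN])

/-! ### The side of a point of `X` on which a cone lies -/

/-- The `i`-th cone contains `t` or stays close to the geodesic from `w` to the base of `t` on a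
length at least `ζ`. -/
def IsSide (hr₀ : 0 < r₀) (π : CoarseProjections Y K) (i : I) (t : ConeOff r₀ Y) (w : X) (ζ : ℝ) :
    Prop :=
  (Y i).Nonempty ∧
    (Outer i t → ζ ≤ gromovProduct (t.base hr₀) (π.proj i (t.base hr₀)) w)

variable {hr₀ : 0 < r₀} {π : CoarseProjections Y K}

theorem IsSide.mono {i : I} {t : ConeOff r₀ Y} {w : X} {ζ ζ' : ℝ} (h : IsSide hr₀ π i t w ζ)
    (hζ : ζ' ≤ ζ) : IsSide hr₀ π i t w ζ' := ⟨h.1, fun ho => hζ.trans (h.2 ho)⟩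

theorem dist_proj_add_le (π : CoarseProjections Y K) (hK : 0 ≤ K) {i : I} (a : X) {e : X}
    (he : e ∈ Y i) : dist a (π.proj i a) + dist (π.proj i a) e ≤ dist a e + 2 * K := by
  have h := π.split i ⟨e, he⟩ a e
  rw [π.fix i e he, dist_self] at h
  rcases h with h | h
  · linarith [dist_triangle a e (π.proj i a), dist_comm e (π.proj i a)]
  · linarith

/-- The projection is almost on a geodesic from the base of `t` to `e`, so replacing `e` by it
lowers the Gromov product at `w` by at most `K`. -/
theorem isSide_of_mem (hK : 0 ≤ K) {i : I} {t : ConeOff r₀ Y} {w e : X} {ζ : ℝ} (he : e ∈ Y i)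
    (h : ζ + K ≤ gromovProduct (t.base hr₀) e w) : IsSide hr₀ π i t w ζ := by
  refine ⟨⟨e, he⟩, fun _ => ?_⟩
  have h1 := dist_proj_add_le π hK (t.base hr₀) he
  unfold gromovProduct at *
  linarith [dist_triangle w (π.proj i (t.base hr₀)) e]

theorem isSide_of_not_outer {i : I} {t : ConeOff r₀ Y} (w : X) (ζ : ℝ) (h : ¬ Outer i t) :
    IsSide hr₀ π i t w ζ := by
  obtain ⟨u, -⟩ := exists_eq_cone_of_not_outer i h
  exact ⟨⟨_, u.base.2⟩, fun ho => absurd ho h⟩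

/-- A path from the base of `t` to `w'` passes near the projection of that base. Hence the Gromov
product at `w` of the two is almost the distance from `w` to the projection, and this is small when
the cone is not a side of `t`. -/
theorem dist_proj_le_of_not_isSide (hK : 0 ≤ K) {i : I} {t : ConeOff r₀ Y} {w w' : X} {ζ κ : ℝ}
    (h : ¬ IsSide hr₀ π i t w ζ) (hw' : w' ∈ Y i) (hww' : dist w w' ≤ κ) :
    Outer i t ∧ dist w (π.proj i (t.base hr₀)) ≤ ζ + κ + K := by
  unfold IsSide at h
  push Not at h
  obtain ⟨h1, h2⟩ := h ⟨w', hw'⟩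
  refine ⟨h1, ?_⟩
  have h3 := dist_proj_add_le π hK (t.base hr₀) hw'
  unfold gromovProduct at h2
  linarith [dist_triangle (t.base hr₀) w w', dist_triangle w w' (π.proj i (t.base hr₀)),
    dist_comm w (t.base hr₀), dist_comm w' (π.proj i (t.base hr₀))]

/-- In a tree the distance from `w` to `[e, e']` is the Gromov product of `e` and `e'` at `w`, and
it is attained at distance `(w|e')_e` from `e`. -/
theorem exists_near_of_gromovProduct_le (hX : IsGromovHyperbolic X K) {Z : Set X}
    (hZ : IsCoarselyConvex K Z) {e e' w : X} (he : e ∈ Z) (he' : e' ∈ Z) {κ : ℝ}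
    (h : gromovProduct e e' w ≤ κ) : ∃ w' ∈ Z, dist w w' ≤ κ + 3 * K := by
  unfold gromovProduct at h
  obtain ⟨w', hw', h1, h2⟩ := hZ e he e' he' ((dist w e + dist e e' - dist w e') / 2)
    ⟨by linarith [dist_triangle w e e'],
      by linarith [dist_triangle w e' e, dist_comm e e']⟩
  refine ⟨w', hw', ?_⟩
  have a1 := abs_le.1 h1
  have a2 := abs_le.1 h2
  have h4 := hX.four_point w w' e e'
  rcases max_cases (dist w e + dist w' e') (dist w e' + dist w' e) with ⟨h, _⟩ | ⟨h, _⟩ <;>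
    rw [h] at h4 <;> linarith [dist_comm w' e]

theorem gromovProduct_comm (x y w : X) : gromovProduct x y w = gromovProduct y x w := by
  unfold gromovProduct; rw [dist_comm x y]; ring

/-- Seen from `w`, each projection lies in the direction of its own point, so `w` remains between
them when the points are replaced by their projections. Each replacement costs `K`. -/
theorem IsSide.gromovProduct_le (hX : IsGromovHyperbolic X K)
    {i : I} {t y : ConeOff r₀ Y} {w : X} {ζ ζ' : ℝ} (hζ : 2 * K < ζ) (hζ' : 3 * K < ζ')
    (ht : IsSide hr₀ π i t w ζ) (hy : IsSide hr₀ π i y w ζ')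
    (hw : gromovProduct (t.base hr₀) (y.base hr₀) w ≤ K) (hK : 0 ≤ K) :
    gromovProduct (π.proj i (t.base hr₀)) (π.proj i (y.base hr₀)) w ≤ 3 * K := by
  have fix : ∀ z : ConeOff r₀ Y, ¬ Outer i z → π.proj i (z.base hr₀) = z.base hr₀ := by
    intro z hz
    obtain ⟨u, rfl⟩ := exists_eq_cone_of_not_outer i hz
    exact π.fix i _ u.base.2
  have h1 : gromovProduct (π.proj i (t.base hr₀)) (y.base hr₀) w ≤ 2 * K := by
    by_cases ho : Outer i t
    · have h2 := ht.2 ho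
      have h3 := hX (t.base hr₀) (π.proj i (t.base hr₀)) (y.base hr₀) w
      rcases min_le_iff.1 (sub_le_iff_le_add.1 h3) with h | h <;> linarith
    · rw [fix t ho]; linarith
  by_cases ho : Outer i y
  · have h2 := hy.2 ho
    have h3 := hX (π.proj i (t.base hr₀)) (π.proj i (y.base hr₀)) (y.base hr₀) w
    rw [gromovProduct_comm (π.proj i (y.base hr₀)) (y.base hr₀)] at h3
    rcases min_le_iff.1 (sub_le_iff_le_add.1 h3) with h | h <;> linarith
  · rw [fix y ho]; linarith

theorem gromovProduct_le_dist {Z : Type*} [PseudoMetricSpace Z] (x y w : Z) : gromovProduct x y w ≤ dist w y := by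
  unfold gromovProduct
  linarith [dist_triangle w y x, dist_comm x y]

/-! ### Cut points -/

/-- A walk from `t` to `y` passes near a point `w` between their bases, unless a cone contains a
neighbourhood of `w` on the way from `t` to `y`. -/
theorem Walk.dist_add_le_of_cut {L₀ E : ℝ} (hG : HasCoarseGates hr₀ π L₀ E) (hK : 0 ≤ K)
    (hE : 0 ≤ E) (hX : IsGromovHyperbolic X K) (hY : ∀ i, IsCoarselyConvex K (Y i))
    {t y z : ConeOff r₀ Y} {w : X} {ζ θ : ℝ} (hζ : 0 ≤ ζ)
    (hno : ∀ i, IsSide hr₀ π i t w ζ → ¬ IsSide hr₀ π i y w ζ)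
    {n : ℕ} {L : ℝ} (h : Walk z y n L) (hθ : ζ + (n + 1) * K ≤ θ) (hL : dist t z + L < L₀) :
    θ - n * K ≤ gromovProduct (z.base hr₀) (y.base hr₀) w ∨
      dist t (ConeOff.point r₀ Y w) + dist (ConeOff.point r₀ Y w) y ≤
        dist t z + L + (E + 2 * (ζ + θ + 4 * K)) := by
  -- A cone passing near `w` on the side of `y` is not a side of `t`. The projection of `t` to it is
  -- therefore near `w`, and a path from `t` to any point of that cone passes near that projection.
  have hcone : ∀ (i : I) (u : Cone r₀ (Y i)) (w' : X), w' ∈ Y i → dist w w' ≤ θ + 3 * K →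
      IsSide hr₀ π i y w ζ → dist t (ConeOff.cone i u) < L₀ →
      dist t (ConeOff.point r₀ Y w) + dist (ConeOff.point r₀ Y w) (ConeOff.cone i u) ≤
        dist t (ConeOff.cone i u) + (E + 2 * (ζ + θ + 4 * K)) := by
    intro i u w' hw' hww' hy htu
    have hns : ¬ IsSide hr₀ π i t w ζ := fun h => hno i h hy
    obtain ⟨ho, hd⟩ := dist_proj_le_of_not_isSide hK hns hw' hww'
    have hg := hG.foot_le i ⟨w', hw'⟩ t u htu
    rw [foot_of_outer hr₀ π i ⟨w', hw'⟩ ho] at hg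
    have d1 := dist_point_le (r₀ := r₀) (Y := Y) w (π.proj i (t.base hr₀))
    set p := ConeOff.point r₀ Y (π.proj i (t.base hr₀))
    set W := ConeOff.point r₀ Y w
    linarith [dist_triangle t p W, dist_triangle W p (ConeOff.cone i u), dist_comm p W]
  induction h with
  | nil y =>
    -- The first alternative of the induction says that the walk has so far stayed on the side of
    -- `y`. It loses `K` at each step, hence the threshold `θ - n * K`.
    rcases le_or_gt θ (dist w (y.base hr₀)) with hle | hlt
    · left
      unfold gromovProduct
      rw [dist_self]
      push_cast
      linarith
    · right
      by_cases hin : y.inner = none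
      · have hy := eq_point_of_inner hr₀ y hin
        have d1 := dist_point_le (r₀ := r₀) (Y := Y) w (y.base hr₀)
        rw [← hy] at d1
        linarith [dist_triangle t y (ConeOff.point r₀ Y w), dist_comm y (ConeOff.point r₀ Y w)]
      · obtain ⟨⟨i, u⟩, hu⟩ := Option.ne_none_iff_exists'.1 hin
        obtain ⟨rfl, -⟩ := eq_cone_of_inner hu
        have := hcone i u u.base u.base.2 (by rw [base_cone] at hlt; linarith)
          (isSide_of_not_outer w ζ (fun ho => ho u hu)) (by linarith)
        linarith
  | @point x x' y n L h ih =>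
    push_cast at hθ ⊢
    have d1 := dist_point_le (r₀ := r₀) (Y := Y) x x'
    set a := ConeOff.point r₀ Y x
    set a' := ConeOff.point r₀ Y x'
    rcases ih hno (by linarith) (by linarith [dist_triangle t a a']) hcone with ih | ih
    · have h4 := hX x x' (y.base hr₀) w
      change θ - n * K ≤ gromovProduct x' (y.base hr₀) w at ih
      change θ - (n + 1) * K ≤ gromovProduct x (y.base hr₀) w ∨ _
      rcases le_or_gt θ (gromovProduct x x' w) with hg | hg
      · left
        have hnK : 0 ≤ n * K := by positivity
        have := le_min (show θ - n * K ≤ gromovProduct x x' w by linarith) ih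
        linarith
      · right
        unfold gromovProduct at hg
        have d2 := dist_point_le (r₀ := r₀) (Y := Y) w x
        have d3 := dist_point_le (r₀ := r₀) (Y := Y) w x'
        have hd := h.dist_le
        set W := ConeOff.point r₀ Y w
        linarith [dist_triangle t a W, dist_triangle W a' y, dist_comm a W]
    · right
      linarith [dist_triangle t a a']
  | @cone i u u' y n L h ih =>
    push_cast at hθ ⊢
    have d1 := dist_cone_le i u u' (Y := Y)
    set a := (ConeOff.cone i u : ConeOff r₀ Y) with ha
    set a' := (ConeOff.cone i u' : ConeOff r₀ Y)
    rcases ih hno (by linarith) (by linarith [dist_triangle t a a']) hcone with ih | ih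
    · have h4 := hX u.base u'.base (y.base hr₀) w
      change θ - n * K ≤ gromovProduct (u'.base : X) (y.base hr₀) w at ih
      change θ - (n + 1) * K ≤ gromovProduct (u.base : X) (y.base hr₀) w ∨ _
      rcases le_or_gt θ (gromovProduct (u.base : X) u'.base w) with hg | hg
      · left
        have hnK : 0 ≤ n * K := by positivity
        have := le_min (show θ - n * K ≤ gromovProduct (u.base : X) u'.base w by linarith) ih
        linarith
      · right
        -- The chord jumps over `w`, so its base passes near `w`. One of its ends is on the side of
        -- `y`, so the cone is a side of `y` and `hcone` applies.
        obtain ⟨w', hw', hww'⟩ := exists_near_of_gromovProduct_le hX (hY i) u.base.2 u'.base.2 hg.le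
        have hs : IsSide hr₀ π i y w ζ := by
          refine isSide_of_mem hK u'.base.2 ?_
          rw [gromovProduct_comm]
          linarith
        have h0 := dist_nonneg.trans h.dist_le
        have hc := hcone i u w' hw' hww' hs (by linarith [Cone.distance_nonneg u u'])
        have hd := h.dist_le
        rw [← ha] at hc
        set W := ConeOff.point r₀ Y w
        linarith [dist_triangle W a y, dist_triangle a a' y]
    · right
      linarith [dist_triangle t a a']

end

end ConeOff

/-! ### Comparison points in the cone-off and hyperbolicity of bounded subsets -/

namespace ConeOff

section

variable {X I : Type*} [MetricSpace X] {r₀ : ℝ} {Y : I → Set X} {K : ℝ} {hr₀ : 0 < r₀}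
  {π : CoarseProjections Y K} {L₀ β : ℝ} {N : ℕ}

theorem dist_add_le_of_cut (hG : HasCoarseGates hr₀ π L₀ (5 * β)) (hK : 0 ≤ K) (hβ : 0 < β)
    (hX : IsGromovHyperbolic X K) (hY : ∀ i, IsCoarselyConvex K (Y i)) (hNK : (N + 20) * K ≤ β)
    (hW : ∀ z w : ConeOff r₀ Y, dist z w < L₀ → ∃ n ≤ N, ∃ L ≤ dist z w + β, Walk z w n L)
    {t y : ConeOff r₀ Y} {w : X} (hty : dist t y + β < L₀)
    (hno : ∀ i, IsSide hr₀ π i t w (40 * β) → ¬ IsSide hr₀ π i y w (40 * β))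
    (hw : gromovProduct (t.base hr₀) (y.base hr₀) w ≤ K) :
    dist t (point r₀ Y w) + dist (point r₀ Y w) y ≤ dist t y + 168 * β := by
  obtain ⟨n, hn, L, hL, h⟩ := hW t y (by linarith)
  have hnN : (n : ℝ) * K ≤ N * K := mul_le_mul_of_nonneg_right (by exact_mod_cast hn) hK
  have hnK : 0 ≤ n * K := by positivity
  -- With this `θ` the first alternative would give a Gromov product above `K`, contrary to `hw`.
  -- The second gives `5β + 2 (80β + (N + 6) K) + β`, which is at most `168β`.
  rcases h.dist_add_le_of_cut hG hK (by linarith) hX hY (θ := 40 * β + (N + 2) * K)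
    (by linarith) hno (by linarith) (by rw [dist_self]; linarith) with h | h
  · linarith
  · rw [dist_self] at h
    linarith

/-- A point `w` of `X` between the bases of `t` and `y` is almost on a geodesic from `t` to `x` or
on a geodesic from `x` to `y`. -/
theorem dist_add_le_or_of_cut (hG : HasCoarseGates hr₀ π L₀ (5 * β)) (hK : 0 ≤ K) (hβ : 0 < β)
    (hX : IsGromovHyperbolic X K) (hY : ∀ i, IsCoarselyConvex K (Y i)) (hNK : (N + 20) * K ≤ β)
    (hW : ∀ z w : ConeOff r₀ Y, dist z w < L₀ → ∃ n ≤ N, ∃ L ≤ dist z w + β, Walk z w n L)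
    {t y x : ConeOff r₀ Y} {w : X} (htx : dist t x + β < L₀) (hyx : dist y x < L₀)
    (hno : ∀ i, IsSide hr₀ π i t w (20 * β) → ¬ IsSide hr₀ π i y w (20 * β))
    (hw : gromovProduct (t.base hr₀) (x.base hr₀) w ≤ K) :
    dist t (point r₀ Y w) + dist (point r₀ Y w) x ≤ dist t x + 168 * β ∨
      dist y (point r₀ Y w) + dist (point r₀ Y w) x ≤ dist y x + 168 * β := by
  have hN0 : 0 ≤ N * K := by positivity
  -- If a cone extends by `40β` on the sides of both `t` and `x`, it does not extend by `20β` on the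
  -- side of `y`. The projection of `y` to it is then near `w` and that of `x` is far from `w`, so a
  -- path from `y` to `x` passes near `w`. The gap between `20β` and `40β` keeps the two projections
  -- apart.
  by_cases hcut : ∀ i, IsSide hr₀ π i t w (40 * β) → ¬ IsSide hr₀ π i x w (40 * β)
  · exact Or.inl (dist_add_le_of_cut hG hK hβ hX hY hNK hW htx hcut hw)
  · right
    push Not at hcut
    obtain ⟨i, hit, hix⟩ := hcut
    have hi := hit.1
    have hy := hno i (hit.mono (by linarith))
    have hprod := hit.gromovProduct_le hX (by linarith) (by linarith) hix hw hK
    obtain ⟨w', hw', hww'⟩ := exists_near_of_gromovProduct_le hX (hY i) (π.mem i hi _)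
      (π.mem i hi _) hprod
    obtain ⟨ho, hd⟩ := dist_proj_le_of_not_isSide hK hy hw' hww'
    rcases hG.foot_foot_le i hi y x hyx with ⟨-, ho', h⟩ | h
    · exfalso
      have h1 := hix.2 ho'
      have h2 := gromovProduct_le_dist (x.base hr₀) (π.proj i (x.base hr₀)) w
      linarith [dist_triangle w (π.proj i (y.base hr₀)) (π.proj i (x.base hr₀))]
    · rw [foot_of_outer hr₀ π i hi ho] at h
      have d1 := dist_point_le (r₀ := r₀) (Y := Y) w (π.proj i (y.base hr₀))
      set p := point r₀ Y (π.proj i (y.base hr₀))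
      set W := point r₀ Y w
      set q := foot hr₀ π i hi x
      linarith [dist_triangle y p W, dist_comm p W, dist_triangle W p x, dist_triangle p q x]

/-- Comparison for a triangle one of whose sides crosses a cone. -/
theorem exists_comparison_of_cone (hG : HasCoarseGates hr₀ π L₀ (5 * β)) (hK : 0 ≤ K) (hβ : 0 < β)
    (hX : IsGromovHyperbolic X K) (hY : ∀ i, IsCoarselyConvex K (Y i)) (hKβ : 20 * K ≤ β)
    (i : I) (hi : (Y i).Nonempty) (t y : ConeOff r₀ Y) {s e : ℝ}
    (he : 0 ≤ e)
    (hfar : Outer i t → Outer i y →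
      10 * β < dist (π.proj i (t.base hr₀)) (π.proj i (y.base hr₀)))
    (hs : dist t (foot hr₀ π i hi t) - e ≤ s)
    (hs' : s ≤ dist t (foot hr₀ π i hi t) +
      Cone.distance (retract hr₀ π i hi t) (retract hr₀ π i hi y) + e) :
    ∃ v : ConeOff r₀ Y, ∀ x, dist t x + 5 * β < L₀ → dist y x + 5 * β < L₀ →
      dist x v ≤ max (dist x t - s) (dist x y - (dist t y - s)) + Real.log 2 + 21 * β + e := by
  set P := retract hr₀ π i hi t with hP
  set Q := retract hr₀ π i hi y with hQ
  set D := Cone.distance P Q with hD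
  have hD0 : 0 ≤ D := Cone.distance_nonneg _ _
  -- This is the parameter in the cone once the path from `t` to its projection has been travelled.
  -- The clamping to `[0, D]` moves it by at most `e`.
  set σ := max 0 (min (s - dist t (foot hr₀ π i hi t)) D) with hσ
  have hσ0 : 0 ≤ σ := le_max_left _ _
  have hσD : σ ≤ D := max_le hD0 (min_le_right _ _)
  obtain ⟨v, hv⟩ := Cone.exists_comparison_point hr₀ hK hX (hY i) P Q hσ0 hσD
  have hσ1 : s - dist t (foot hr₀ π i hi t) - e ≤ σ := by
    rcases le_total (s - dist t (foot hr₀ π i hi t)) D with h | h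
    · rw [hσ, min_eq_left h]
      exact (by linarith : _ ≤ s - dist t (foot hr₀ π i hi t)).trans (le_max_right _ _)
    · rw [hσ, min_eq_right h, max_eq_right hD0]
      linarith
  have hσ2 : σ ≤ s - dist t (foot hr₀ π i hi t) + e :=
    max_le (by linarith) ((min_le_left _ _).trans (by linarith))
  refine ⟨cone i v, fun x htx hyx => ?_⟩
  set R := retract hr₀ π i hi x with hR
  have hxv : dist x (cone i v) ≤ dist x (foot hr₀ π i hi x) + Cone.distance R v :=
    (dist_triangle _ (foot hr₀ π i hi x) _).trans (add_le_add_right (dist_cone_le _ _ _) _)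
  have hty : dist t y ≤ dist t (foot hr₀ π i hi t) + D + dist (foot hr₀ π i hi y) y := by
    have := dist_foot_le_distance hr₀ π i hi t y
    linarith [dist_triangle4 t (foot hr₀ π i hi t) (foot hr₀ π i hi y) y]
  -- the two sides of the triangle issued from `x`, when they pass through the cone
  have sideP : dist t (foot hr₀ π i hi t) + dist (foot hr₀ π i hi t) (foot hr₀ π i hi x) +
      dist (foot hr₀ π i hi x) x ≤ dist t x + 5 * β →
      dist x (foot hr₀ π i hi x) + (Cone.distance R P - σ) ≤ dist x t - s + 10 * β + e := by
    intro h
    have h1 := hG.retract_le i hi (foot hr₀ π i hi t) (foot hr₀ π i hi x)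
      (by linarith [dist_nonneg (x := t) (y := foot hr₀ π i hi t),
            dist_nonneg (x := foot hr₀ π i hi x) (y := x)])
    rw [retract_foot, retract_foot, ← hP, ← hR, Cone.distance_comm] at h1
    rw [dist_comm x (foot hr₀ π i hi x), dist_comm x t]
    linarith
  have sideQ : dist y (foot hr₀ π i hi y) + dist (foot hr₀ π i hi y) (foot hr₀ π i hi x) +
      dist (foot hr₀ π i hi x) x ≤ dist y x + 5 * β →
      dist x (foot hr₀ π i hi x) + (Cone.distance R Q - (D - σ)) ≤
        dist x y - (dist t y - s) + 10 * β + e := by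
    intro h
    have h1 := hG.retract_le i hi (foot hr₀ π i hi y) (foot hr₀ π i hi x)
      (by linarith [dist_nonneg (x := y) (y := foot hr₀ π i hi y),
            dist_nonneg (x := foot hr₀ π i hi x) (y := x)])
    rw [retract_foot, retract_foot, ← hQ, ← hR, Cone.distance_comm] at h1
    rw [dist_comm x (foot hr₀ π i hi x), dist_comm x y]
    linarith [dist_comm y (foot hr₀ π i hi y)]
  have hmaxP := le_max_left (dist x t - s) (dist x y - (dist t y - s))
  have hmaxQ := le_max_right (dist x t - s) (dist x y - (dist t y - s))
  -- At least one of the sides `[t, x]`, `[y, x]` passes through the projections, since two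
  -- projections within `5β` of that of `x` would contradict `hfar`. If only one does, `R` is close
  -- to `P` or to `Q`, and the comparison at that end suffices.
  rcases hG.foot_foot_le i hi t x (by linarith) with ⟨ot, ox, hl⟩ | hr
  · rcases hG.foot_foot_le i hi y x (by linarith) with ⟨oy, -, hl'⟩ | hr'
    · exfalso
      have := hfar ot oy
      linarith [dist_triangle_right (π.proj i (t.base hr₀)) (π.proj i (y.base hr₀))
        (π.proj i (x.base hr₀))]
    · have h1 := sideQ hr'
      have h2 := (distance_retract_le hr₀ π i hi ot ox).trans hl
      rw [← hP, ← hR] at h2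
      have h3 := hv P
      rw [Cone.distance_self, zero_sub, ← hD, sub_sub_cancel, max_eq_right (by linarith)] at h3
      linarith [Cone.distance_triangle hr₀ R P v, Cone.distance_triangle hr₀ P R Q,
        Cone.distance_comm R P]
  · have h1 := sideP hr
    rcases hG.foot_foot_le i hi y x (by linarith) with ⟨oy, ox, hl'⟩ | hr'
    · have h2 := (distance_retract_le hr₀ π i hi oy ox).trans hl'
      rw [← hQ, ← hR] at h2
      have h3 := hv Q
      rw [Cone.distance_self, zero_sub, ← hD, Cone.distance_comm Q P, ← hD,
        max_eq_left (by linarith)] at h3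
      linarith [Cone.distance_triangle hr₀ R Q v, Cone.distance_triangle hr₀ P R Q,
        Cone.distance_comm R P, Cone.distance_comm R Q]
    · have h2 := sideQ hr'
      have h3 := hv R
      rw [← hD] at h3
      rcases max_cases (Cone.distance R P - σ) (Cone.distance R Q - (D - σ)) with ⟨h, _⟩ | ⟨h, _⟩ <;>
        rw [h] at h3 <;> linarith

theorem abs_height_sub_le_distance (u v : Cone r₀ (Y i)) (hr₀ : 0 < r₀) :
    |u.height - v.height| ≤ Cone.distance u v := by
  rw [Cone.distance_eq]
  exact abs_sub_le_coneMetric hr₀ u.height_nonneg v.height_nonneg dist_nonneg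

/-- Comparison with a point close to an end `t` which lies inside a cone. -/
theorem exists_comparison_of_lt (hG : HasCoarseGates hr₀ π L₀ (5 * β)) (hK : 0 ≤ K) (hβ : 0 < β)
    (hX : IsGromovHyperbolic X K) (hY : ∀ i, IsCoarselyConvex K (Y i)) (hKβ : 20 * K ≤ β)
    (t y : ConeOff r₀ Y) {s : ℝ} (hs : 0 ≤ s) (hsy : s ≤ dist t y)
    (hst : s < dist t (point r₀ Y (t.base hr₀))) :
    ∃ v : ConeOff r₀ Y, ∀ x, dist t x + 5 * β < L₀ → dist y x + 5 * β < L₀ →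
      dist x v ≤ max (dist x t - s) (dist x y - (dist t y - s)) + Real.log 2 + 21 * β := by
  have hin : t.inner ≠ none := by
    intro h
    rw [← eq_point_of_inner hr₀ t h, dist_self] at hst
    linarith
  obtain ⟨⟨i, u⟩, hu⟩ := Option.ne_none_iff_exists'.1 hin
  obtain ⟨rfl, -⟩ := eq_cone_of_inner hu
  have hi : (Y i).Nonempty := ⟨_, u.base.2⟩
  have ho : ¬ Outer i (cone i u : ConeOff r₀ Y) := fun h => h u hu
  have hf := foot_of_not_outer hr₀ π i hi ho
  -- If `y` is outside the cone, its projection is at height `r₀`, so the crossing is at least as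
  -- long as the vertical segment from `t` to its base point.
  have hs' : s ≤ Cone.distance (retract hr₀ π i hi (cone i u)) (retract hr₀ π i hi y) := by
    by_cases hy : Outer i y
    · have h1 := abs_height_sub_le_distance u (retract hr₀ π i hi y) hr₀
      rw [retract_cone]
      rw [retract_of_outer hr₀ π i hi hy, Cone.height_top] at h1
      rw [retract_of_outer hr₀ π i hi hy]
      refine hst.le.trans (le_trans ?_ h1)
      rw [base_cone, ← cone_top hr₀]
      refine (dist_cone_le _ _ _).trans (le_of_eq ?_)
      rw [Cone.distance_eq, Cone.base_top, dist_self, coneMetric_zero, Cone.height_top]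
    · have h1 := dist_foot_le_distance hr₀ π i hi (cone i u) y
      rw [hf, foot_of_not_outer hr₀ π i hi hy] at h1
      linarith
  obtain ⟨v, hv⟩ := exists_comparison_of_cone hG hK hβ hX hY hKβ i hi (cone i u) y (s := s)
    (e := 0) le_rfl (fun h => absurd h ho) (by rw [hf, dist_self]; linarith)
    (by rw [hf, dist_self]; linarith)
  exact ⟨v, fun x h1 h2 => by linarith [hv x h1 h2]⟩

/-- Comparison with a point `w` of `X` between the bases of `t` and `y`. -/
theorem exists_comparison_of_between (hG : HasCoarseGates hr₀ π L₀ (5 * β)) (hK : 0 ≤ K)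
    (hβ : 0 < β)
    (hX : IsGromovHyperbolic X K) (hY : ∀ i, IsCoarselyConvex K (Y i)) (hNK : (N + 20) * K ≤ β)
    (hW : ∀ z w : ConeOff r₀ Y, dist z w < L₀ → ∃ n ≤ N, ∃ L ≤ dist z w + β, Walk z w n L)
    (t y : ConeOff r₀ Y) (w : X)
    (hw : gromovProduct (t.base hr₀) (y.base hr₀) w ≤ 0)
    (hwy : dist t (point r₀ Y w) ≤ dist t y) (hty : dist t y + 5 * β < L₀) :
    ∃ v : ConeOff r₀ Y, ∀ x, dist t x + 5 * β < L₀ → dist y x + 5 * β < L₀ →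
      dist x v ≤ max (dist x t - dist t (point r₀ Y w))
        (dist x y - (dist t y - dist t (point r₀ Y w))) + Real.log 2 + 168 * β := by
  have hN0 : 0 ≤ N * K := by positivity
  have hlog : 0 < Real.log 2 := Real.log_pos one_lt_two
  by_cases hex : ∃ i, IsSide hr₀ π i t w (20 * β) ∧ IsSide hr₀ π i y w (20 * β)
  · obtain ⟨i, hit, hiy⟩ := hex
    have hi := hit.1
    have hprod := hit.gromovProduct_le hX (by linarith) (by linarith) hiy (by linarith) hK
    obtain ⟨w', hw', hww'⟩ := exists_near_of_gromovProduct_le hX (hY i) (π.mem i hi _)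
      (π.mem i hi _) hprod
    have d1 := dist_point_le (r₀ := r₀) (Y := Y) w w'
    have ec : (cone i (Cone.top hr₀ ⟨w', hw'⟩) : ConeOff r₀ Y) = point r₀ Y w' := cone_top hr₀ _ _
    have hprod' := hprod
    unfold gromovProduct at hprod'
    -- Both projections are at least `20β` away from `w`, which is almost between them.
    have hfar : Outer i t → Outer i y →
        10 * β < dist (π.proj i (t.base hr₀)) (π.proj i (y.base hr₀)) := by
      intro ot oy
      have h1 := hit.2 ot
      have h2 := hiy.2 oy
      have h3 := gromovProduct_le_dist (t.base hr₀) (π.proj i (t.base hr₀)) w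
      have h4 := gromovProduct_le_dist (y.base hr₀) (π.proj i (y.base hr₀)) w
      linarith
    have hlow : dist t (foot hr₀ π i hi t) - 6 * β ≤ dist t (point r₀ Y w) := by
      have h1 := hG.foot_le i hi t (Cone.top hr₀ ⟨w', hw'⟩) (by
        rw [ec]; linarith [dist_triangle t (point r₀ Y w) (point r₀ Y w')])
      rw [ec] at h1
      linarith [dist_triangle t (point r₀ Y w) (point r₀ Y w'),
        dist_nonneg (x := foot hr₀ π i hi t) (y := point r₀ Y w')]
    have hupp : dist t (point r₀ Y w) ≤ dist t (foot hr₀ π i hi t) +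
        Cone.distance (retract hr₀ π i hi t) (retract hr₀ π i hi y) + 6 * β := by
      by_cases oy : Outer i y
      · have h1 : dist (foot hr₀ π i hi t) (point r₀ Y w') ≤
            Cone.distance (retract hr₀ π i hi t) (Cone.top hr₀ ⟨w', hw'⟩) := by
          rw [← ec]; exact dist_cone_le _ _ _
        have h2 : Cone.distance (retract hr₀ π i hi t) (Cone.top hr₀ ⟨w', hw'⟩) ≤
            Cone.distance (retract hr₀ π i hi t) (retract hr₀ π i hi y) + 12 * K := by
          rw [retract_of_outer hr₀ π i hi oy, Cone.distance_eq, Cone.distance_eq, Cone.base_top,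
            Cone.base_top, Cone.height_top, Cone.height_top]
          refine coneMetric_le_add hr₀ (Cone.height_nonneg _) hr₀.le le_rfl dist_nonneg dist_nonneg
            (by linarith) ?_
          change dist ((retract hr₀ π i hi t).base : X) w' ≤
            dist ((retract hr₀ π i hi t).base : X) (π.proj i (y.base hr₀)) + 12 * K
          rw [base_retract]
          linarith [dist_triangle (π.proj i (t.base hr₀)) w w',
            dist_comm w (π.proj i (t.base hr₀)),
            dist_nonneg (x := w) (y := π.proj i (y.base hr₀))]
        linarith [dist_triangle t (foot hr₀ π i hi t) (point r₀ Y w'),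
          dist_triangle t (point r₀ Y w') (point r₀ Y w),
          dist_comm (point r₀ Y w') (point r₀ Y w)]
      · have h1 := dist_foot_le_distance hr₀ π i hi t y
        rw [foot_of_not_outer hr₀ π i hi oy] at h1
        linarith [dist_triangle t (foot hr₀ π i hi t) y]
    obtain ⟨v, hv⟩ := exists_comparison_of_cone hG hK hβ hX hY (by linarith) i hi t y
      (by linarith : 0 ≤ 6 * β) hfar hlow hupp
    exact ⟨v, fun x h1 h2 => by linarith [hv x h1 h2]⟩
  -- No cone extends on both sides of `w`, and `w` is its own comparison point. By hyperbolicity of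
  -- `X`, it is almost between the base of `x` and one of the bases of `t` and `y`, so it is a
  -- coarse cut point for one of the sides issued from `x`.
  · push Not at hex
    refine ⟨point r₀ Y w, fun x htx hyx => ?_⟩
    have hmaxP := le_max_left (dist x t - dist t (point r₀ Y w))
      (dist x y - (dist t y - dist t (point r₀ Y w)))
    have hmaxQ := le_max_right (dist x t - dist t (point r₀ Y w))
      (dist x y - (dist t y - dist t (point r₀ Y w)))
    have htri := dist_triangle t (point r₀ Y w) y
    have c1 := dist_comm x t
    have c2 := dist_comm x y
    have c3 := dist_comm x (point r₀ Y w)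
    have c4 := dist_comm y (point r₀ Y w)
    have h4 := hX (t.base hr₀) (x.base hr₀) (y.base hr₀) w
    rcases min_le_iff.1 (sub_le_iff_le_add.1 h4) with h | h
    · rcases dist_add_le_or_of_cut hG hK hβ hX hY hNK hW (by linarith) (by linarith) hex
        (show gromovProduct (t.base hr₀) (x.base hr₀) w ≤ K by linarith) with h' | h' <;> linarith
    · rw [gromovProduct_comm] at h
      rcases dist_add_le_or_of_cut hG hK hβ hX hY hNK hW (by linarith) (by linarith)
        (fun i h1 h2 => hex i h2 h1)
        (show gromovProduct (y.base hr₀) (x.base hr₀) w ≤ K by linarith) with h' | h' <;> linarith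

/-- Coarse `CAT(-1)` comparison for triangles of bounded size in the cone-off. -/
theorem exists_comparison_point (hG : HasCoarseGates hr₀ π L₀ (5 * β)) (hK : 0 ≤ K)
    (hβ : 0 < β) (hgeo : IsGeodesicSpace X)
    (hX : IsGromovHyperbolic X K) (hY : ∀ i, IsCoarselyConvex K (Y i)) (hNK : (N + 20) * K ≤ β)
    (hW : ∀ z w : ConeOff r₀ Y, dist z w < L₀ → ∃ n ≤ N, ∃ L ≤ dist z w + β, Walk z w n L)
    (t y : ConeOff r₀ Y) {s : ℝ} (hs : 0 ≤ s) (hsy : s ≤ dist t y) (hty : dist t y + 5 * β < L₀) :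
    ∃ v : ConeOff r₀ Y, ∀ x, dist t x + 5 * β < L₀ → dist y x + 5 * β < L₀ →
      dist x v ≤ max (dist x t - s) (dist x y - (dist t y - s)) + Real.log 2 + 168 * β := by
  have hN0 : 0 ≤ N * K := by positivity
  rcases lt_or_ge s (dist t (point r₀ Y (t.base hr₀))) with h1 | h1
  · obtain ⟨v, hv⟩ := exists_comparison_of_lt hG hK hβ hX hY (by linarith) t y hs hsy h1
    exact ⟨v, fun x h h' => by linarith [hv x h h']⟩
  rcases lt_or_ge (dist t y - s) (dist y (point r₀ Y (y.base hr₀))) with h2 | h2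
  · obtain ⟨v, hv⟩ := exists_comparison_of_lt hG hK hβ hX hY (by linarith) y t (s := dist t y - s)
      (by linarith) (by rw [dist_comm y t]; linarith) h2
    refine ⟨v, fun x h h' => ?_⟩
    have h3 := hv x h' h
    rw [dist_comm y t, sub_sub_cancel, max_comm] at h3
    linarith
  obtain ⟨γ, h0, h3, hγ⟩ := hgeo (t.base hr₀) (y.base hr₀)
  set ℓ := dist (t.base hr₀) (y.base hr₀) with hℓ
  have hcont : ContinuousOn (fun τ => dist t (point r₀ Y (γ τ))) (Set.Icc 0 ℓ) := by
    refine LipschitzOnWith.continuousOn (K := 1) (LipschitzOnWith.of_dist_le_mul ?_)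
    intro a ha b hb
    rw [NNReal.coe_one, one_mul, Real.dist_eq, Real.dist_eq, ← hγ a ha b hb]
    rw [dist_comm t, dist_comm t]
    exact (abs_dist_sub_le _ _ _).trans (dist_point_le _ _)
  -- The remaining values of `s` lie between the distances from `t` to the two base points, so
  -- continuity along the geodesic of `X` provides a point at distance exactly `s` from `t`.
  have hmem : s ∈ Set.Icc (dist t (point r₀ Y (γ 0))) (dist t (point r₀ Y (γ ℓ))) := by
    rw [h0, h3]
    refine ⟨h1, ?_⟩
    linarith [dist_triangle t (point r₀ Y (y.base hr₀)) y, dist_comm y (point r₀ Y (y.base hr₀))]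
  obtain ⟨τ, hτ, hτs⟩ := intermediate_value_Icc dist_nonneg hcont hmem
  have hτs : dist t (point r₀ Y (γ τ)) = s := hτs
  have hw : gromovProduct (t.base hr₀) (y.base hr₀) (γ τ) ≤ 0 := by
    have e1 := hγ τ hτ 0 ⟨le_rfl, dist_nonneg⟩
    have e2 := hγ τ hτ ℓ ⟨dist_nonneg, le_rfl⟩
    rw [h0, sub_zero, abs_of_nonneg hτ.1] at e1
    rw [h3, abs_sub_comm, abs_of_nonneg (by linarith [hτ.2])] at e2
    unfold gromovProduct
    rw [e1, e2, ← hℓ]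
    linarith
  obtain ⟨v, hv⟩ := exists_comparison_of_between hG hK hβ hX hY hNK hW t y (γ τ) hw
    (by rw [hτs]; exact hsy) hty
  rw [hτs] at hv
  exact ⟨v, hv⟩

/-- Bounded subsets of the cone-off are hyperbolic. -/
theorem isGromovHyperbolic_of_dist_lt (hG : HasCoarseGates hr₀ π L₀ (5 * β)) (hK : 0 ≤ K)
    (hβ : 0 < β) (hgeo : IsGeodesicSpace X)
    (hX : IsGromovHyperbolic X K) (hY : ∀ i, IsCoarselyConvex K (Y i)) (hNK : (N + 20) * K ≤ β)
    (hW : ∀ z w : ConeOff r₀ Y, dist z w < L₀ → ∃ n ≤ N, ∃ L ≤ dist z w + β, Walk z w n L)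
    (B : Set (ConeOff r₀ Y)) (hB : ∀ x ∈ B, ∀ y ∈ B, dist x y + 5 * β < L₀) :
    IsGromovHyperbolic B (Real.log 2 + 168 * β) := by
  rintro ⟨x, hx⟩ ⟨y, hy⟩ ⟨z, hz⟩ ⟨t, ht⟩
  change min (gromovProduct x y t) (gromovProduct y z t) - _ ≤ gromovProduct x z t
  set s := min (gromovProduct x y t) (gromovProduct y z t) with hs
  have h1 : s ≤ gromovProduct x y t := min_le_left _ _
  have h2 : s ≤ gromovProduct y z t := min_le_right _ _
  have hs0 : 0 ≤ s := by
    refine le_min ?_ ?_ <;> unfold gromovProduct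
    · linarith [dist_triangle x t y, dist_comm x t]
    · linarith [dist_triangle y t z, dist_comm y t]
  have hsy : s ≤ dist t y := h1.trans (gromovProduct_le_dist x y t)
  obtain ⟨v, hv⟩ := exists_comparison_point hG hK hβ hgeo hX hY hNK hW t y hs0 hsy (hB t ht y hy)
  have hx1 := hv x (hB t ht x hx) (hB y hy x hx)
  have hz1 := hv z (hB t ht z hz) (hB y hy z hz)
  unfold gromovProduct at h1 h2 ⊢
  -- The inequality `s ≤ (x|y)_t` says precisely that the first term of the maximum dominates; the
  -- same holds for `z`.
  rw [max_eq_left (by linarith [dist_comm x t, dist_comm x y])] at hx1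
  rw [max_eq_left (by linarith [dist_comm z t, dist_comm z y])] at hz1
  linarith [dist_triangle x v z, dist_comm x t, dist_comm z t, dist_comm z v]

end

end ConeOff

end

/-! ### Choice of the constants -/

theorem mainTheorem6 (r₀ : ℝ) (hr₀ : 0 < r₀) (ε : ℝ) (hε : 0 < ε) :
    ∃ δ Δ : ℝ, 0 < δ ∧ 0 < Δ ∧
      ∀ (X : Type*) [MetricSpace X] (I : Type*) (Y : I → Set X),
        IsGeodesicSpace X →
        IsGromovHyperbolic X δ →
        (∀ i, IsClosed (Y i)) →
        (∀ i, IsQuasiConvex (10 * δ) (Y i)) →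
        largestPiece δ Y ≤ ENNReal.ofReal Δ →
        ∀ x₀ : ConeOff r₀ Y,
          (∀ v ∈ ConeOff.vertices r₀ Y, r₀ / 2 < dist x₀ v) →
          IsGromovHyperbolic (Metric.ball x₀ (r₀ / 9)) (Real.log 3 + ε) := by
  -- The order of the choices is `ε`, then the precision `β`, then the number of steps `N` at scale
  -- `r₀ + 10`, then `K` with `(N + 20) K = β`. Finally `δ = K / 120` and `Δ = K / 2` make the
  -- projection constant `Δ + 60δ` equal to `K`. The scale leaves room for the diameter `2 r₀ / 9`
  -- of the ball and the margin `5β`.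
  obtain ⟨β, hβ, hβ1, hβε⟩ : ∃ β : ℝ, 0 < β ∧ β ≤ 1 ∧ 168 * β ≤ ε :=
    ⟨min 1 (ε / 168), by positivity, min_le_left _ _, by linarith [min_le_right 1 (ε / 168)]⟩
  obtain ⟨N, hN⟩ := ConeOff.exists_walk_le (L₀ := r₀ + 10) hr₀ (by linarith) hβ
  have hN0 : (0 : ℝ) < N + 20 := by positivity
  obtain ⟨K, hK, hNK⟩ : ∃ K : ℝ, 0 < K ∧ (N + 20) * K = β :=
    ⟨β / (N + 20), by positivity, by field_simp⟩
  refine ⟨K / 120, K / 2, by positivity, by positivity, ?_⟩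
  intro X _ I Y hgeo hX _ hY hpiece x₀ _
  obtain ⟨π⟩ := exists_coarseProjections (by positivity) (by positivity) hgeo hX hY hpiece
  rw [show K / 2 + 60 * (K / 120) = K by ring] at π
  have hW := hN X I Y
  have hG : ConeOff.HasCoarseGates hr₀ π (r₀ + 10) (5 * β) :=
    ConeOff.hasCoarseGates hr₀ π hK.le (by linarith) hβ.le hW
  have hB := ConeOff.isGromovHyperbolic_of_dist_lt hG hK.le hβ hgeo (hX.mono (by linarith))
    (fun i => (hY i).isCoarselyConvex (by positivity) hgeo (by linarith)) hNK.le hW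
    (Metric.ball x₀ (r₀ / 9)) fun x hx y hy => by
      linarith [dist_triangle_right x y x₀, Metric.mem_ball.1 hx, Metric.mem_ball.1 hy]
  refine hB.mono ?_
  linarith [Real.log_le_log two_pos (by norm_num : (2 : ℝ) ≤ 3)]
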